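/- Let $N\ge 2$, let $Y=\{y_1,\dots,y_N\}$ consist of $N$ distinct points of $\mathbb R^3$, and let $a=(a_1,\dots,a_N)\in\mathbb C^N$. Consider the $N\times N$ matrix $$\Gamma_{a,Y}(z)=\Big[\big(a_j-\tfrac{iz}{4\pi}\big)\delta_{jj'}-\widetilde G_z(y_j-y_{j'})\Big]_{j,j'=1}^N,\qquad \widetilde G_z(x)=\frac{e^{iz|x|}}{4\pi|x|}\ (x\ne0),\quad \widetilde G_z(0)=0 .$$ The multiset $\Sigma(H_{a,Y})$ of resonances of the point-interaction Hamiltonian $H_{a,Y}$ with centres $Y$ and strength tuple $a$ is, by definition, the multiset of zeros of the entire function $z\mapsto\det\Gamma_{a,Y}(z)$, each repeated according to its multiplicity. Write $D(\zeta):=(-4\pi)^N\det\Gamma_{a,Y}(i\zeta)=\sum_{j=0}^{\nu}P_{\beta_j}(\zeta)e^{\beta_j\zeta}$ with real $\beta_0<\dots<\beta_\nu=0$ and polynomials $P_{\beta_j}\not\equiv0$, and put $T_{\beta_j}=(\beta_j,\deg P_{\beta_j})\in\mathbb R^2$. The distribution diagram of $D$ is the polygonal line that joins $T_{\beta_0}$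 with $T_{\beta_\nu}$, has vertices only at points $T_{\beta_j}$, is convex upward (that is, the graph of a concave function), and has no point $T_{\beta_j}$ above it. Let $\operatorname{Ln}$ be the principal branch of the logarithm, with $\operatorname{Ln}z=\ln|z|+i\pi$ for $z<0$. Then there exist $M\in\mathbb N$, $M_0\in\mathbb N\cup\{0\}$, numbers $\mu_n>0$ and $r_n\in\mathbb N$ for $1\le n\le M$, numbers $\omega_{n,j}\in\mathbb C\setminus\{0\}$ and $t_{n,j}\in\mathbb N$ for $1\le n\le M$, $1\le j\le r_n$, a finite sequence $\mathcal K_0=\{k^{[0]}_t\}_{t=1}^{M_0}\subset\mathbb C$, and infinite sequences $\mathcal K^{\pm}_{n,j}=\{k^{\pm}_{n,j,t}\}_{t=t_{n,j}}^{\infty}\subset\mathbb C$, such that $M$ is the number of (maximal) segments of the distribution diagram of $D$, $\mu_1,\dots,\mu_M$ are the slopes of these segments from left to right, and: (i) $\Sigma(H_{a,Y})$ is the union, taking multiplicities into account, of $\mathcal K_0$ and of all the sequences $\mathcal K_{n,j}^{+}$ and $\mathcal K_{n,j}^{-}$, $1\le n\le M$, $1\le j\le r_n$; (ii) for all $n$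 and $j$, and for each choice of the sign, as $t\in\mathbb N$ tends to $+\infty$, $$\frac{k^{\pm}_{n,j,t}}{\mu_n}=\pm2\pi t-i\operatorname{Ln}t\mp\frac{\pi}{2}-i\operatorname{Ln}(2\pi\mu_n)+i\operatorname{Ln}\omega_{n,j}+o(1);$$ (iii) the sequence $\mu_1,\dots,\mu_M$ is strictly decreasing and $\mu_M=1/\operatorname{diam}Y$; (iv) $1\le M\le N-1$ and $2\le r_M\le\sum_{n=1}^M r_n\le N$. -/

import Mathlib

open scoped Polynomial

namespace PointInteraction

noncomputable section

/-- Configurations of `N` interaction centres live in Euclidean three-space. -/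
abbrev E3 : Type := EuclideanSpace ℝ (Fin 3)

/-- The kernel `G_z(x) = exp(i z |x|) / (4 π |x|)` for `x ≠ 0`, set to be `0` at `x = 0`. -/
def greenTilde (z : ℂ) (x : E3) : ℂ :=
  if x = 0 then 0
  else Complex.exp (Complex.I * z * (‖x‖ : ℂ)) / (4 * (Real.pi : ℂ) * (‖x‖ : ℂ))

/-- The matrix `Γ_{a,Y}(z)` occurring in the Krein-type resolvent formula of `H_{a,Y}`. -/
def Gam {N : ℕ} (a : Fin N → ℂ) (y : Fin N → E3) (z : ℂ) : Matrix (Fin N) (Fin N) ℂ :=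
  Matrix.of fun j j' =>
    (if j = j' then a j - Complex.I * z / (4 * (Real.pi : ℂ)) else 0)
      - greenTilde z (y j - y j')

/-- The multiset of resonances `Σ(H_{a,Y})`, given by its multiplicity function: the multiplicity
of `k` is its multiplicity as a zero of the entire function `det Γ_{a,Y}`
(it is `0` if `k` is not a resonance). -/
def resonanceMult {N : ℕ} (a : Fin N → ℂ) (y : Fin N → E3) (k : ℂ) : ℕ∞ :=
  analyticOrderAt (fun z => (Gam a y z).det) k

/-- The modified characteristic determinant `D(ζ) = (-4π)^N det Γ_{a,Y}(i ζ)`. -/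
def modDet {N : ℕ} (a : Fin N → ℂ) (y : Fin N → E3) (ζ : ℂ) : ℂ :=
  (-4 * (Real.pi : ℂ)) ^ N * (Gam a y (Complex.I * ζ)).det

/-- `α(σ) = - ∑_{σ(j) ≠ j} |y_j - y_{σ(j)}|`. -/
def alpha {N : ℕ} (y : Fin N → E3) (σ : Equiv.Perm (Fin N)) : ℝ :=
  -∑ j with σ j ≠ j, ‖y j - y (σ j)‖

/-- `p^{[σ]}(ζ) = sign(σ) ∏_{σ(j) ≠ j} |y_j - y_{σ(j)}|⁻¹ ∏_{σ(j) = j} (-ζ - 4 π a_j)`. -/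
def permPoly {N : ℕ} (a : Fin N → ℂ) (y : Fin N → E3) (σ : Equiv.Perm (Fin N)) : ℂ[X] :=
  Polynomial.C (((Equiv.Perm.sign σ : ℤ) : ℂ) * ((∏ j with σ j ≠ j, ‖y j - y (σ j)‖⁻¹ : ℝ) : ℂ))
    * ∏ j with σ j = j, (-Polynomial.X - Polynomial.C (4 * (Real.pi : ℂ) * a j))

/-- The polynomial coefficient `P_β` of `exp(β ζ)` in the canonical form of `D`. -/
def freqPoly {N : ℕ} (a : Fin N → ℂ) (y : Fin N → E3) (β : ℝ) : ℂ[X] :=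
  ∑ σ with alpha y σ = β, permPoly a y σ

/-- The frequencies of `D`: those `β` with `P_β ≠ 0`. -/
def freqs {N : ℕ} (a : Fin N → ℂ) (y : Fin N → E3) : Finset ℝ :=
  (Finset.univ.image (alpha y)).filter fun β => freqPoly a y β ≠ 0

/-- The canonical form `D(ζ) = ∑_β P_β(ζ) exp(β ζ)`. -/
theorem modDet_eq_sum {N : ℕ} (a : Fin N → ℂ) (y : Fin N → E3) (hy : Function.Injective y)
    (ζ : ℂ) :
    modDet a y ζ = ∑ β ∈ freqs a y, (freqPoly a y β).eval ζ * Complex.exp ((β : ℂ) * ζ) := by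
  have hterm : ∀ σ : Equiv.Perm (Fin N),
      (-4 * (Real.pi : ℂ)) ^ N * (((Equiv.Perm.sign σ : ℤ) : ℂ) *
        ∏ i, Gam a y (Complex.I * ζ) (σ i) i) =
      (permPoly a y σ).eval ζ * Complex.exp ((alpha y σ : ℂ) * ζ) := by
    intro σ
    have hpi : (Real.pi : ℂ) ≠ 0 := Complex.ofReal_ne_zero.mpr Real.pi_ne_zero
    have hent : ∀ i, (-4 * (Real.pi : ℂ)) * Gam a y (Complex.I * ζ) (σ i) i =
        if σ i = i then -ζ - 4 * (Real.pi : ℂ) * a i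
        else ((‖y i - y (σ i)‖⁻¹ : ℝ) : ℂ) *
          Complex.exp (-(‖y i - y (σ i)‖ : ℂ) * ζ) := by
      intro i
      by_cases h : σ i = i
      · simp only [Gam, Matrix.of_apply, h, if_true, sub_self, greenTilde, sub_zero]
        field_simp
        linear_combination ζ * Complex.I_sq
      · have hne : y (σ i) - y i ≠ 0 := sub_ne_zero.mpr fun e => h (hy e)
        have hn : (‖y i - y (σ i)‖ : ℂ) ≠ 0 := by
          rw [norm_sub_rev]; exact_mod_cast norm_ne_zero_iff.mpr hne
        have harg : Complex.I * (Complex.I * ζ) * (‖y i - y (σ i)‖ : ℂ) =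
            -(‖y i - y (σ i)‖ : ℂ) * ζ := by
          linear_combination ζ * (‖y i - y (σ i)‖ : ℂ) * Complex.I_sq
        simp only [Gam, Matrix.of_apply, h, if_false, greenTilde, hne,
          norm_sub_rev (y (σ i)) (y i), harg, Complex.ofReal_inv]
        field_simp
        ring
    have hprod : (-4 * (Real.pi : ℂ)) ^ N * ∏ i, Gam a y (Complex.I * ζ) (σ i) i =
        ∏ i, (-4 * (Real.pi : ℂ)) * Gam a y (Complex.I * ζ) (σ i) i := by
      rw [Finset.prod_mul_distrib]; simp
    have hexp : Complex.exp ((alpha y σ : ℂ) * ζ) =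
        ∏ i with σ i ≠ i, Complex.exp (-(‖y i - y (σ i)‖ : ℂ) * ζ) := by
      rw [← Complex.exp_sum, alpha]
      push_cast
      rw [← Finset.sum_neg_distrib, Finset.sum_mul]
    rw [mul_left_comm, hprod, Finset.prod_congr rfl fun i _ => hent i, Finset.prod_ite,
      Finset.prod_mul_distrib, hexp, permPoly, Polynomial.eval_mul, Polynomial.eval_prod]
    simp only [Polynomial.eval_C, Polynomial.eval_sub, Polynomial.eval_neg, Polynomial.eval_X,
      Complex.ofReal_prod]
    ring
  rw [modDet, Matrix.det_apply', Finset.mul_sum, Finset.sum_congr rfl fun σ _ => hterm σ,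
    freqs, Finset.sum_filter_of_ne]
  · rw [← Finset.sum_fiberwise_of_maps_to (g := alpha y) (t := Finset.univ.image (alpha y))
      fun σ hσ => Finset.mem_image_of_mem _ hσ]
    refine Finset.sum_congr rfl fun β _ => ?_
    rw [freqPoly, Polynomial.eval_finsetSum, Finset.sum_mul]
    refine Finset.sum_congr rfl fun σ hσ => ?_
    rw [(Finset.mem_filter.mp hσ).2]
  · intro β _ h h0
    exact h (by rw [h0]; simp)

/-- The height `deg P_β` of the point `T_β = (β, deg P_β)` over the frequency `β`. -/
def height {N : ℕ} (a : Fin N → ℂ) (y : Fin N → E3) (β : ℝ) : ℝ :=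
  ((freqPoly a y β).natDegree : ℝ)

/-- The slope of the segment that joins `T_β` with `T_β'`. -/
def slopeT {N : ℕ} (a : Fin N → ℂ) (y : Fin N → E3) (β β' : ℝ) : ℝ :=
  (height a y β' - height a y β) / (β' - β)

/-- The distribution diagram of `D`: the polygonal line with the `M` successive segments
`[T_{b n}, T_{b (n+1)}]`, with vertices among the points `T_β`, which joins the leftmost of these
points with the rightmost one, is convex upward (the segments being maximal, consecutive slopes
differ), and has none of the points `T_β` above it. -/
structure IsDistributionDiagram {N : ℕ} (a : Fin N → ℂ) (y : Fin N → E3) {M : ℕ}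
    (b : Fin (M + 1) → ℝ) : Prop where
  mem : ∀ i, b i ∈ freqs a y
  strictMono : StrictMono b
  first_le : ∀ β ∈ freqs a y, b 0 ≤ β
  le_last : ∀ β ∈ freqs a y, β ≤ b (Fin.last M)
  slopes_strictAnti : StrictAnti fun n : Fin M => slopeT a y (b n.castSucc) (b n.succ)
  below : ∀ n : Fin M, ∀ β ∈ freqs a y, b n.castSucc ≤ β → β ≤ b n.succ →
    height a y β ≤
      height a y (b n.castSucc) + slopeT a y (b n.castSucc) (b n.succ) * (β - b n.castSucc)

end

end PointInteraction

/-!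
The resonances are the zeros of `det Γ(z)`, that is, with `z = i ζ`, of the exponential polynomial
`D(ζ) = ∑_β P_β(ζ) exp(β ζ)` with real frequencies `β ≤ 0`. The size of the term of frequency `β`
is about `exp(deg P_β * log |ζ| + β * Re ζ)`, so the terms that can dominate are those on the upper
hull of the points `(β, deg P_β)`, the distribution diagram. A large zero needs two comparable
dominating terms, hence lies where `Re ζ = -μ log |ζ| + O(1)` for the slope `μ` of a segment, that
is, where `w = ζ exp(ζ / μ)` stays in a compact part of `ℂ \ {0}`
(`exists_slope_eventually_log_le`). There `D`, divided by the term at the left end of the segment,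
is asymptotic to a polynomial `q` in `w` formed by the leading coefficients on the segment
(`tendsto_expPoly_div`). The degree of `q` is the difference of the heights of the end points of the
segment, and `q(0) ≠ 0`. So the large zeros are close to the solutions of `ζ exp(ζ / μ) = ρ` with
`q(ρ) = 0`, and taking logarithms twice shows that these are, up to `o(1)`, the points
`centre μ ρ k`, `k ∈ ℤ` (`exists_tendsto_sub_centre`). Conversely, translated to `centre μ ρ k` and
normalized, `D` converges locally uniformly to `q(ρ exp(v / μ)) exp(β₀ v)` as `|k| → ∞`, so
Hurwitz's theorem, which is derived here from the argument principle, gives exactly as many zeros in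
a small disc around `centre μ ρ k` as the multiplicity of the root `ρ` says
(`eventually_zeros_near_centre`). These discs are disjoint far out, and only finitely many zeros lie
outside of them; the zeros in the discs are distributed over sequences, one for each sign of `k` and
each root of `q`, counted with multiplicity (`exists_sequences_of_discs`).

The statements on the parameters come from the expansion of the determinant over permutations. A
permutation that moves `m` points contributes degree `N - m` and a frequency at least `-m d`, where
`d` is the diameter, so that all points lie below the line of slope `1 / d` through `(0, N)`. The
identity puts `(0, N)` on this line, and the transpositions of two points at distance `d`, which
all have the same sign, put `(-2 d, N - 2)` on it. Hence the last segment has slope `1 / d` and its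
polynomial has degree at least two, while the degrees of all the polynomials add up to at most `N`.
-/

namespace PointInteraction

open Filter Topology Metric
open Bornology (cobounded IsBounded isBounded_def eventually_ne_cobounded)

/-! ### Counting the zeros of entire functions -/

theorem analyticOrderAt_sub_self (z : ℂ) : analyticOrderAt (fun w : ℂ => w - z) z = 1 := by
  simpa only [pow_one, Nat.cast_one] using!
    analyticOrderAt_centeredMonomial (𝕜 := ℂ) (z₀ := z) (n := 1)

/-- A zero of finite order splits off globally, so that the cofactor stays entire. -/
theorem exists_pow_mul_of_differentiable {f : ℂ → ℂ} (hf : Differentiable ℂ f) (z₀ : ℂ)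
    (n : ℕ) (hn : analyticOrderAt f z₀ = n) :
    ∃ g : ℂ → ℂ, Differentiable ℂ g ∧ (∀ z, f z = (z - z₀) ^ n * g z) ∧ g z₀ ≠ 0 := by
  induction n generalizing f with
  | zero =>
    refine ⟨f, hf, by simp, ?_⟩
    exact ((hf.analyticAt z₀).analyticOrderAt_eq_zero).1 (by simpa using hn)
  | succ n ih =>
    have h0 : f z₀ = 0 := apply_eq_zero_of_analyticOrderAt_ne_zero (by rw [hn]; simp)
    have hd : Differentiable ℂ (dslope f z₀) := by
      rw [← differentiableOn_univ] at hf ⊢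
      exact (Complex.differentiableOn_dslope univ_mem).2 hf
    have hfac : ∀ z, f z = (z - z₀) * dslope f z₀ z := fun z => by
      simpa [h0] using (sub_smul_dslope f z₀ z).symm
    have hord : analyticOrderAt (dslope f z₀) z₀ = n := by
      have h1 : f = (fun z => z - z₀) * dslope f z₀ := funext hfac
      rw [h1, analyticOrderAt_mul (by fun_prop) (hd.analyticAt z₀),
        analyticOrderAt_sub_self] at hn
      push_cast at hn
      rw [add_comm] at hn
      exact (ENat.add_left_injective_of_ne_top (by simp)) hn
    obtain ⟨g, hg, hfg, hg0⟩ := ih hd hord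
    exact ⟨g, hg, fun z => by rw [hfac, hfg]; ring, hg0⟩

theorem analyticOrderAt_ne_top_of_differentiable {f : ℂ → ℂ} (hf : Differentiable ℂ f)
    (hf0 : f ≠ 0) (z : ℂ) : analyticOrderAt f z ≠ ⊤ := fun h =>
  hf0 ((AnalyticOnNhd.analyticOrderAt_eq_top_iff_eq_zero z fun w => hf.analyticAt w).1 h)

theorem exists_multiset_factor_finset {f : ℂ → ℂ} (hf : Differentiable ℂ f) (hf0 : f ≠ 0)
    (T : Finset ℂ) :
    ∃ (S : Multiset ℂ) (g : ℂ → ℂ), (∀ s ∈ S, s ∈ T) ∧ Differentiable ℂ g ∧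
      (∀ z, f z = (S.map fun s => z - s).prod * g z) ∧ ∀ z ∈ T, g z ≠ 0 := by
  classical
  induction T using Finset.induction_on with
  | empty => exact ⟨0, f, by simp, hf, by simp, by simp⟩
  | insert a T ha ih =>
    obtain ⟨S, g, hS, hg, hfg, hgT⟩ := ih
    have hg0 : g ≠ 0 := by
      rintro rfl
      exact hf0 (funext fun z => by simp [hfg z])
    obtain ⟨n, hn⟩ := ENat.ne_top_iff_exists.1 (analyticOrderAt_ne_top_of_differentiable hg hg0 a)
    obtain ⟨h, hh, hgh, hha⟩ := exists_pow_mul_of_differentiable hg a n hn.symm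
    refine ⟨S + Multiset.replicate n a, h, ?_, hh, fun z => ?_, ?_⟩
    · intro s hs
      rcases Multiset.mem_add.1 hs with hs | hs
      · exact Finset.mem_insert_of_mem (hS s hs)
      · rw [Multiset.eq_of_mem_replicate hs]; exact Finset.mem_insert_self _ _
    · rw [hfg, hgh]; simp [mul_assoc]
    · intro z hz
      rcases Finset.mem_insert.1 hz with rfl | hz
      · exact hha
      · intro hz0
        exact hgT z hz (by rw [hgh, hz0, mul_zero])

theorem finite_zeros_of_isCompact {f : ℂ → ℂ} (hf : Differentiable ℂ f) (hf0 : f ≠ 0)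
    {K : Set ℂ} (hK : IsCompact K) : {z ∈ K | f z = 0}.Finite := by
  obtain ⟨x, hx⟩ : ∃ x, f x ≠ 0 := by
    by_contra! h
    exact hf0 (funext h)
  have h1 := AnalyticOnNhd.preimage_zero_mem_codiscrete (f := f) (fun z _ => hf.analyticAt z) hx
  have h2 := hK.finite_sdiff_of_mem_codiscreteWithin (codiscreteWithin_mono (Set.subset_univ K) h1)
  refine h2.subset fun z hz => ⟨hz.1, ?_⟩
  simpa using hz.2

/-- On a compact set, a nonzero entire function is a product of linear factors times an entire
function without zeros there. -/
theorem exists_multiset_factor {f : ℂ → ℂ} (hf : Differentiable ℂ f) (hf0 : f ≠ 0)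
    {K : Set ℂ} (hK : IsCompact K) :
    ∃ (S : Multiset ℂ) (g : ℂ → ℂ), (∀ s ∈ S, s ∈ K ∧ f s = 0) ∧ Differentiable ℂ g ∧
      (∀ z, f z = (S.map fun s => z - s).prod * g z) ∧ ∀ z ∈ K, g z ≠ 0 := by
  obtain ⟨S, g, hS, hg, hfg, hgT⟩ := exists_multiset_factor_finset hf hf0
    (finite_zeros_of_isCompact hf hf0 hK).toFinset
  refine ⟨S, g, fun s hs => by simpa using hS s hs, hg, hfg, fun z hz hgz => ?_⟩
  exact hgT z (by simpa using ⟨hz, by rw [hfg, hgz, mul_zero]⟩) hgz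

theorem differentiable_multiset_prod_sub (S : Multiset ℂ) :
    Differentiable ℂ fun w : ℂ => (S.map fun s => w - s).prod := by
  induction S using Multiset.induction_on with
  | empty => simp
  | cons a S ih =>
    simp only [Multiset.map_cons, Multiset.prod_cons]
    exact Differentiable.mul (by fun_prop) ih

theorem analyticOrderAt_multiset_prod_mul (S : Multiset ℂ) {g : ℂ → ℂ} (hg : Differentiable ℂ g)
    (z : ℂ) :
    analyticOrderAt (fun w => (S.map fun s => w - s).prod * g w) z =
      (S.count z : ℕ∞) + analyticOrderAt g z := by
  induction S using Multiset.induction_on with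
  | empty => simp
  | cons a S ih =>
    have h1 : (fun w => ((a ::ₘ S).map fun s => w - s).prod * g w) =
        (fun w => w - a) * fun w => (S.map fun s => w - s).prod * g w := by
      funext w; simp [mul_assoc]
    have hd : Differentiable ℂ fun w => (S.map fun s => w - s).prod * g w :=
      (differentiable_multiset_prod_sub S).mul hg
    rw [h1, analyticOrderAt_mul (by fun_prop) (hd.analyticAt z), ih, Multiset.count_cons]
    by_cases h : z = a
    · subst h
      rw [analyticOrderAt_sub_self]; simp; ring
    · have h2 : analyticOrderAt (fun w : ℂ => w - a) z = 0 :=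
        (AnalyticAt.analyticOrderAt_eq_zero (by fun_prop)).2 (sub_ne_zero.2 h)
      rw [h2]; simp [h]

theorem circleIntegral_logDeriv_of_ne_zero {g : ℂ → ℂ} (hg : Differentiable ℂ g) {c : ℂ} {R : ℝ}
    (hR : 0 ≤ R) (h0 : ∀ z ∈ closedBall c R, g z ≠ 0) : (∮ z in C(c, R), logDeriv g z) = 0 := by
  have hd : ∀ z ∈ closedBall c R, DifferentiableAt ℂ (logDeriv g) z := fun z hz => by
    have h1 : AnalyticAt ℂ (deriv g) z := (hg.analyticAt z).deriv
    exact h1.differentiableAt.div (hg z) (h0 z hz)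
  refine Complex.circleIntegral_eq_zero_of_differentiable_on_off_countable hR
    Set.countable_empty (fun z hz => (hd z hz).continuousAt.continuousWithinAt) fun z hz => ?_
  exact hd z (ball_subset_closedBall hz.1)

theorem continuousOn_logDeriv {f : ℂ → ℂ} (hf : Differentiable ℂ f) {K : Set ℂ}
    (h0 : ∀ z ∈ K, f z ≠ 0) : ContinuousOn (logDeriv f) K := fun z hz =>
  ((hf.analyticAt z).deriv.continuousAt.div (hf z).continuousAt (h0 z hz)).continuousWithinAt

/-- The argument principle for a function given with its zeros split off. -/
theorem circleIntegral_logDeriv_multiset_prod_mul (S : Multiset ℂ) {g : ℂ → ℂ}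
    (hg : Differentiable ℂ g) {c : ℂ} {R : ℝ} (hR : 0 ≤ R) (hS : ∀ s ∈ S, s ∈ ball c R)
    (h0 : ∀ z ∈ closedBall c R, g z ≠ 0) :
    (∮ z in C(c, R), logDeriv (fun w => (S.map fun s => w - s).prod * g w) z) =
      2 * Real.pi * Complex.I * S.card := by
  induction S using Multiset.induction_on with
  | empty => simpa using circleIntegral_logDeriv_of_ne_zero hg hR h0
  | cons a S ih =>
    have hd : Differentiable ℂ fun w => (S.map fun s => w - s).prod * g w :=
      (differentiable_multiset_prod_sub S).mul hg
    have hne : ∀ z ∈ sphere c R, (S.map fun s => z - s).prod * g z ≠ 0 := fun z hz => by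
      refine mul_ne_zero (fun h => ?_) (h0 z (sphere_subset_closedBall hz))
      obtain ⟨s, hs, hs0⟩ := Multiset.mem_map.1 (Multiset.prod_eq_zero_iff.1 h)
      have := hS s (Multiset.mem_cons_of_mem hs)
      rw [← sub_eq_zero.1 hs0] at this
      exact (ne_of_lt (mem_ball.1 this)) (mem_sphere.1 hz)
    have ha := hS a (Multiset.mem_cons_self a S)
    have hane : ∀ z ∈ sphere c R, z - a ≠ 0 := fun z hz h => by
      rw [← sub_eq_zero.1 h] at ha
      exact (ne_of_lt (mem_ball.1 ha)) (mem_sphere.1 hz)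
    have h1 : ∀ z ∈ sphere c R,
        logDeriv (fun w => ((a ::ₘ S).map fun s => w - s).prod * g w) z =
          (z - a)⁻¹ + logDeriv (fun w => (S.map fun s => w - s).prod * g w) z := fun z hz => by
      have h2 : (fun w => ((a ::ₘ S).map fun s => w - s).prod * g w) =
          fun w => (w - a) * ((S.map fun s => w - s).prod * g w) := by
        funext w; simp [mul_assoc]
      rw [h2, logDeriv_mul z (hane z hz) (hne z hz) (by fun_prop) (hd z)]
      congr 1
      simp [logDeriv_apply]
    rw [circleIntegral.integral_congr hR h1, circleIntegral.integral_add,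
      circleIntegral.integral_sub_inv_of_mem_ball ha,
      ih fun s hs => hS s (Multiset.mem_cons_of_mem hs)]
    · simp; ring
    · refine ContinuousOn.circleIntegrable hR ?_
      exact ContinuousOn.inv₀ (by fun_prop) hane
    · exact (continuousOn_logDeriv hd hne).circleIntegrable hR

theorem eventually_ne_zero_of_tendstoLocallyUniformly {ι : Type*} {l : Filter ι}
    {f : ι → ℂ → ℂ} {g : ℂ → ℂ} (hg : Continuous g)
    (hfg : TendstoLocallyUniformlyOn f g l Set.univ) {K : Set ℂ} (hK : IsCompact K)
    (h0 : ∀ z ∈ K, g z ≠ 0) : ∀ᶠ i in l, ∀ z ∈ K, f i z ≠ 0 := by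
  rcases K.eq_empty_or_nonempty with rfl | hne
  · simp
  obtain ⟨x, hx, hmin⟩ := hK.exists_isMinOn hne hg.norm.continuousOn
  have hu := (tendstoLocallyUniformlyOn_iff_tendstoUniformlyOn_of_compact hK).1
    (hfg.mono (Set.subset_univ K))
  have h1 := Metric.tendstoUniformlyOn_iff.1 hu ‖g x‖ (norm_pos_iff.2 (h0 x hx))
  filter_upwards [h1] with i hi z hz hfz
  have h2 := hi z hz
  rw [hfz, dist_zero_right] at h2
  exact absurd (hmin hz) (not_le.2 h2)

/-- **Hurwitz's theorem** with multiplicities: if entire functions converge locally uniformly to an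
entire function whose only zero in a closed disc is the centre, of order `m`, then eventually they
have exactly `m` zeros in the disc. The zeros are recorded as a multiset. -/
theorem eventually_exists_zeros_of_tendstoLocallyUniformly {ι : Type*} {l : Filter ι}
    [l.IsCountablyGenerated] {f : ι → ℂ → ℂ} {g : ℂ → ℂ} (hf : ∀ i, Differentiable ℂ (f i))
    (hg : Differentiable ℂ g) (hfg : TendstoLocallyUniformlyOn f g l Set.univ) {c : ℂ} {R : ℝ}
    (hR : 0 < R) (h0 : ∀ z ∈ closedBall c R, z ≠ c → g z ≠ 0) {m : ℕ}
    (hm : analyticOrderAt g c = m) :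
    ∀ᶠ i in l, ∃ S : Multiset ℂ, S.card = m ∧ (∀ s ∈ S, s ∈ ball c R) ∧
      ∀ z ∈ closedBall c R, analyticOrderAt (f i) z = S.count z := by
  classical
  have hsne : ∀ z ∈ sphere c R, g z ≠ 0 := fun z hz =>
    h0 z (sphere_subset_closedBall hz) (ne_of_mem_sphere hz hR.ne')
  have hsph := eventually_ne_zero_of_tendstoLocallyUniformly hg.continuous hfg
    (isCompact_sphere c R) hsne
  -- the limit has winding number `m` along the circle
  have hgint : (∮ z in C(c, R), logDeriv g z) = 2 * Real.pi * Complex.I * m := by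
    obtain ⟨h, hh, hgh, hhc⟩ := exists_pow_mul_of_differentiable hg c m hm
    have h1 : g = fun w => ((Multiset.replicate m c).map fun s => w - s).prod * h w := by
      funext w; simp [hgh]
    rw [h1, circleIntegral_logDeriv_multiset_prod_mul _ hh hR.le]
    · simp
    · intro s hs
      rw [Multiset.eq_of_mem_replicate hs]
      exact mem_ball_self hR
    · intro z hz hhz
      by_cases hzc : z = c
      · exact hhc (hzc ▸ hhz)
      · exact h0 z hz hzc (by rw [hgh, hhz, mul_zero])
  have hunif : TendstoUniformlyOn (fun i => logDeriv (f i)) (logDeriv g) l (sphere c R) := by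
    refine (tendstoLocallyUniformlyOn_iff_tendstoUniformlyOn_of_compact (isCompact_sphere c R)).1 ?_
    have h1 := hfg.deriv (Eventually.of_forall fun i => (hf i).differentiableOn) isOpen_univ
    refine TendstoLocallyUniformlyOn.div₀ (h1.mono (Set.subset_univ _))
      (hfg.mono (Set.subset_univ _)) ?_ hg.continuous.continuousOn hsne
    exact fun z _ => (hg.analyticAt z).deriv.continuousAt.continuousWithinAt
  have hlim := hunif.tendsto_circleIntegral_of_continuousOn hR.le
    (hsph.mono fun i hi => continuousOn_logDeriv (hf i) hi)
  rw [hgint] at hlim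
  have hclose := Metric.tendsto_nhds.1 hlim (2 * Real.pi) Real.two_pi_pos
  filter_upwards [hsph, hclose] with i hi hci
  have hfi0 : f i ≠ 0 := fun h =>
    hi (c + R) (by simp [hR.le]) (by rw [h]; rfl)
  obtain ⟨S, h, hS, hh, hfh, hh0⟩ := exists_multiset_factor (hf i) hfi0
    (isCompact_closedBall c R)
  have hSb : ∀ s ∈ S, s ∈ ball c R := fun s hs => by
    refine mem_ball.2 (lt_of_le_of_ne (mem_closedBall.1 (hS s hs).1) fun he => ?_)
    exact hi s (mem_sphere.2 he) (hS s hs).2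
  have hfi : f i = fun w => (S.map fun s => w - s).prod * h w := funext hfh
  refine ⟨S, ?_, hSb, fun z hz => ?_⟩
  · rw [hfi, circleIntegral_logDeriv_multiset_prod_mul S hh hR.le hSb hh0, dist_eq_norm,
      ← mul_sub, norm_mul] at hci
    have h2 : ‖(2 * Real.pi * Complex.I : ℂ)‖ = 2 * Real.pi := by
      simp [abs_of_pos Real.pi_pos]
    rw [h2] at hci
    have h3 : ‖((S.card : ℂ) - m)‖ < 1 := by
      have := Real.two_pi_pos
      nlinarith
    have h4 : ‖(((S.card : ℤ) - m : ℤ) : ℂ)‖ < 1 := by push_cast; exact h3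
    rw [Complex.norm_intCast] at h4
    have h5 : |((S.card : ℤ) - m : ℤ)| < 1 := by exact_mod_cast h4
    have h6 := Int.abs_lt_one_iff.1 h5
    omega
  · rw [hfi, analyticOrderAt_multiset_prod_mul S hh,
      ((hh.analyticAt z).analyticOrderAt_eq_zero).2 (hh0 z hz), add_zero]

/-! ### Upper hulls of finite planar sets -/

/-- The slope of the chord of `h` over `[β, β']`. -/
noncomputable def chordSlope (h : ℝ → ℝ) (β β' : ℝ) : ℝ := (h β' - h β) / (β' - β)

/-- `b 0 < ⋯ < b M` are the abscissae of the vertices of the upper concave hull of the points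
`(β, h β)`, `β ∈ F`. In contrast to `IsDistributionDiagram`, the line through each segment is
required to bound all of the points, and strictly so away from the segment. -/
structure IsUpperHull (F : Finset ℝ) (h : ℝ → ℝ) {M : ℕ} (b : Fin (M + 1) → ℝ) : Prop where
  mem : ∀ i, b i ∈ F
  strictMono : StrictMono b
  first_le : ∀ β ∈ F, b 0 ≤ β
  le_last : ∀ β ∈ F, β ≤ b (Fin.last M)
  slopes_strictAnti : StrictAnti fun n : Fin M => chordSlope h (b n.castSucc) (b n.succ)
  le_line : ∀ n : Fin M, ∀ β ∈ F,
    h β ≤ h (b n.castSucc) + chordSlope h (b n.castSucc) (b n.succ) * (β - b n.castSucc)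
  lt_line : ∀ n : Fin M, ∀ β ∈ F, (β < b n.castSucc ∨ b n.succ < β) →
    h β < h (b n.castSucc) + chordSlope h (b n.castSucc) (b n.succ) * (β - b n.castSucc)

theorem add_chordSlope_mul (h : ℝ → ℝ) {β β' : ℝ} (hne : β ≠ β') :
    h β + chordSlope h β β' * (β' - β) = h β' := by
  rw [chordSlope, div_mul_cancel₀ _ (sub_ne_zero.2 hne.symm)]; ring

/-- The hull is built from left to right: after the longest chord of largest slope that starts at the
first point, it continues with the hull of the points to the right of that chord. -/
theorem exists_isUpperHull (h : ℝ → ℝ) (F : Finset ℝ) (hF : F.Nonempty) :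
    ∃ (M : ℕ) (b : Fin (M + 1) → ℝ), IsUpperHull F h b := by
  induction F using Finset.strongInduction with
  | H F ih =>
    set β₀ := F.min' hF with hβ₀
    have hβ₀F : β₀ ∈ F := F.min'_mem hF
    have hmin : ∀ β ∈ F, β₀ ≤ β := fun β hβ => F.min'_le β hβ
    rcases (F.erase β₀).eq_empty_or_nonempty with he | hne
    · have hall : ∀ β ∈ F, β = β₀ := fun β hβ => by
        by_contra hb
        have : β ∈ F.erase β₀ := Finset.mem_erase.2 ⟨hb, hβ⟩
        simp [he] at this
      refine ⟨0, fun _ => β₀, fun _ => hβ₀F, Subsingleton.strictMono (α := Fin 1) _, hmin,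
        fun β hβ => (hall β hβ).le, fun n => n.elim0, fun n => n.elim0, fun n => n.elim0⟩
    -- among the chords of largest slope from the first point, take the longest one
    obtain ⟨β₁, hβ₁, hmax⟩ := (F.erase β₀).exists_max_image
      (fun β => toLex (chordSlope h β₀ β, β)) hne
    have hβ₁F : β₁ ∈ F := Finset.mem_of_mem_erase hβ₁
    have h01 : β₀ < β₁ := lt_of_le_of_ne (hmin _ hβ₁F) (Finset.ne_of_mem_erase hβ₁).symm
    have hchord : ∀ β ∈ F, β₀ < β → chordSlope h β₀ β ≤ chordSlope h β₀ β₁ ∧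
        (β₁ < β → chordSlope h β₀ β < chordSlope h β₀ β₁) := fun β hβ hlt => by
      have := hmax β (Finset.mem_erase.2 ⟨hlt.ne', hβ⟩)
      rcases (Prod.Lex.toLex_le_toLex.1 this) with h1 | ⟨h1, h2⟩
      · exact ⟨h1.le, fun _ => h1⟩
      · exact ⟨h1.le, fun h3 => absurd h3 (not_lt.2 h2)⟩
    have hline : ∀ β ∈ F, h β ≤ h β₀ + chordSlope h β₀ β₁ * (β - β₀) := fun β hβ => by
      rcases (hmin β hβ).eq_or_lt with rfl | hlt
      · simp
      · rw [← add_chordSlope_mul h hlt.ne]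
        have := (hchord β hβ hlt).1
        have h3 : 0 < β - β₀ := sub_pos.2 hlt
        gcongr
    have hline' : ∀ β ∈ F, β₁ < β → h β < h β₀ + chordSlope h β₀ β₁ * (β - β₀) :=
      fun β hβ hlt => by
        have hlt0 := h01.trans hlt
        rw [← add_chordSlope_mul h hlt0.ne]
        have := (hchord β hβ hlt0).2 hlt
        have h3 : 0 < β - β₀ := sub_pos.2 hlt0
        gcongr
    have hsub : F.filter (β₁ ≤ ·) ⊂ F := Finset.filter_ssubset.2 ⟨β₀, hβ₀F, not_le.2 h01⟩
    obtain ⟨M, b, hb⟩ := ih _ hsub ⟨β₁, Finset.mem_filter.2 ⟨hβ₁F, le_rfl⟩⟩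
    have hb0 : b 0 = β₁ := le_antisymm (hb.first_le β₁ (Finset.mem_filter.2 ⟨hβ₁F, le_rfl⟩))
      (Finset.mem_filter.1 (hb.mem 0)).2
    have hbF : ∀ i, b i ∈ F := fun i => (Finset.mem_filter.1 (hb.mem i)).1
    have hbge : ∀ i, β₁ ≤ b i := fun i => (Finset.mem_filter.1 (hb.mem i)).2
    -- every later segment is less steep than the first one
    have hslope : ∀ n : Fin M, chordSlope h (b n.castSucc) (b n.succ) < chordSlope h β₀ β₁ := by
      have hzero : ∀ hM : 0 < M,
          chordSlope h (b (⟨0, hM⟩ : Fin M).castSucc) (b (⟨0, hM⟩ : Fin M).succ) <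
            chordSlope h β₀ β₁ := fun hM => by
        have e0 : b (⟨0, hM⟩ : Fin M).castSucc = β₁ := hb0
        have hlt : β₁ < b (⟨0, hM⟩ : Fin M).succ := by
          rw [← e0]; exact hb.strictMono (Fin.castSucc_lt_succ)
        have h1 := hline' _ (hbF _) hlt
        rw [e0, chordSlope, div_lt_iff₀ (sub_pos.2 hlt)]
        have h2 := add_chordSlope_mul h h01.ne
        nlinarith
      intro n
      have hM : 0 < M := n.pos
      refine lt_of_le_of_lt ?_ (hzero hM)
      exact hb.slopes_strictAnti.antitone (Fin.mk_le_of_le_val (Nat.zero_le _))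
    have hprev : ∀ n : Fin M, ∀ β ∈ F, β < β₁ → h β < h (b n.castSucc) +
        chordSlope h (b n.castSucc) (b n.succ) * (β - b n.castSucc) := fun n β hβ hlt => by
      have h1 := hline β hβ
      have h2 := hb.le_line n β₁ (Finset.mem_filter.2 ⟨hβ₁F, le_rfl⟩)
      have h3 := add_chordSlope_mul h h01.ne
      have h4 := hslope n
      nlinarith [mul_pos (sub_pos.2 h4) (sub_pos.2 hlt)]
    refine ⟨M + 1, Fin.cons β₀ b, ⟨?_, ?_, ?_, ?_, ?_, ?_, ?_⟩⟩
    · intro i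
      induction i using Fin.cases with
      | zero => exact hβ₀F
      | succ i => exact hbF i
    · rw [Fin.strictMono_iff_lt_succ]
      intro i
      induction i using Fin.cases with
      | zero => simpa [hb0] using h01
      | succ i => simpa [← Fin.succ_castSucc] using hb.strictMono (Fin.castSucc_lt_succ (i := i))
    · simpa using hmin
    · intro β hβ
      rw [← Fin.succ_last, Fin.cons_succ]
      by_cases h1 : β₁ ≤ β
      · exact hb.le_last β (Finset.mem_filter.2 ⟨hβ, h1⟩)
      · exact (not_le.1 h1).le.trans (hbge _)
    · intro i j hij
      induction i using Fin.cases with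
      | zero =>
        induction j using Fin.cases with
        | zero => exact absurd hij (lt_irrefl _)
        | succ j => simpa [← Fin.succ_castSucc, hb0] using hslope j
      | succ i =>
        induction j using Fin.cases with
        | zero => exact absurd hij (by simp)
        | succ j =>
          simpa [← Fin.succ_castSucc] using hb.slopes_strictAnti (Fin.succ_lt_succ_iff.1 hij)
    · intro n β hβ
      induction n using Fin.cases with
      | zero => simpa [hb0] using hline β hβ
      | succ n =>
        simp only [← Fin.succ_castSucc, Fin.cons_succ]
        by_cases h1 : β₁ ≤ β
        · exact hb.le_line n β (Finset.mem_filter.2 ⟨hβ, h1⟩)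
        · exact (hprev n β hβ (not_le.1 h1)).le
    · intro n β hβ
      induction n using Fin.cases with
      | zero =>
        simp only [Fin.castSucc_zero, Fin.cons_zero, Fin.cons_succ, hb0]
        rintro (h1 | h1)
        · exact absurd h1 (not_lt.2 (hmin β hβ))
        · exact hline' β hβ h1
      | succ n =>
        simp only [← Fin.succ_castSucc, Fin.cons_succ]
        intro hor
        by_cases h1 : β₁ ≤ β
        · exact hb.lt_line n β (Finset.mem_filter.2 ⟨hβ, h1⟩) hor
        · exact hprev n β hβ (not_le.1 h1)

/-- A line that bounds all the points and meets two of them carries a segment of the hull. -/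
theorem IsUpperHull.exists_slope_eq {F : Finset ℝ} {h : ℝ → ℝ} {M : ℕ} {b : Fin (M + 1) → ℝ}
    (hb : IsUpperHull F h b) {β₀ β₁ s : ℝ} (h₀ : β₀ ∈ F) (h₁ : β₁ ∈ F) (h01 : β₀ < β₁)
    (hs : h β₁ = h β₀ + s * (β₁ - β₀)) (hsup : ∀ β ∈ F, h β ≤ h β₀ + s * (β - β₀)) :
    ∃ n : Fin M, chordSlope h (b n.castSucc) (b n.succ) = s := by
  -- the segment over which `β₀` lies
  obtain ⟨n, hn1, hn2⟩ : ∃ n : Fin M, b n.castSucc ≤ β₀ ∧ β₀ < b n.succ := by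
    by_contra! hcon
    have hall : ∀ i : Fin (M + 1), b i ≤ β₀ := fun i => by
      induction i using Fin.induction with
      | zero => exact hb.first_le β₀ h₀
      | succ i hi => exact hcon i hi
    exact absurd ((hb.le_last β₁ h₁).trans (hall _)) (not_le.2 h01)
  refine ⟨n, ?_⟩
  set m := chordSlope h (b n.castSucc) (b n.succ) with hm
  have hlt : b n.castSucc < b n.succ := hb.strictMono Fin.castSucc_lt_succ
  have e1 := add_chordSlope_mul h hlt.ne
  rw [← hm] at e1
  have l0 := hb.le_line n β₀ h₀
  have l1 := hb.le_line n β₁ h₁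
  rw [← hm] at l0 l1
  have s0 := hsup _ (hb.mem n.castSucc)
  have s1 := hsup _ (hb.mem n.succ)
  -- the supporting line meets the line of the segment at `β₀`
  have heq : h β₀ = h (b n.castSucc) + m * (β₀ - b n.castSucc) := by
    refine le_antisymm l0 ?_
    by_contra! hc
    rcases le_total s m with hle | hle
    · nlinarith [mul_nonneg (sub_nonneg.2 hle) (sub_nonneg.2 hn2.le)]
    · nlinarith [mul_nonneg (sub_nonneg.2 hle) (sub_nonneg.2 hn1)]
  apply le_antisymm
  · by_contra! hc
    nlinarith [mul_pos (sub_pos.2 hc) (sub_pos.2 hn2)]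
  · by_contra! hc
    nlinarith [mul_pos (sub_pos.2 hc) (sub_pos.2 h01)]

/-! ### Exponential polynomials along a segment of the hull -/

/-- The exponential polynomial `∑_{β ∈ F} P_β(ζ) exp(β ζ)`. -/
noncomputable def expPoly (F : Finset ℝ) (P : ℝ → ℂ[X]) (ζ : ℂ) : ℂ :=
  ∑ β ∈ F, (P β).eval ζ * Complex.exp ((β : ℂ) * ζ)

/-- The polynomial in `w = ζ exp(ζ / μ)` formed by the leading terms of those `P_β` whose points
`(β, deg P_β)` lie on the line of slope `μ` through the point over `β₀`, where `β₀` is the leftmost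
frequency on that line. For `μ > 0` the subtraction of degrees is then not truncated. -/
noncomputable def edgePoly (F : Finset ℝ) (P : ℝ → ℂ[X]) (μ β₀ : ℝ) : ℂ[X] :=
  ∑ β ∈ F with ((P β).natDegree : ℝ) = (P β₀).natDegree + μ * (β - β₀),
    Polynomial.C (P β).leadingCoeff * Polynomial.X ^ ((P β).natDegree - (P β₀).natDegree)

theorem differentiable_expPoly (F : Finset ℝ) (P : ℝ → ℂ[X]) : Differentiable ℂ (expPoly F P) := by
  unfold expPoly
  refine Differentiable.fun_sum fun β _ => ?_
  exact (P β).differentiable.mul (by fun_prop)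

theorem tendsto_eval_div_pow_natDegree (p : ℂ[X]) :
    Tendsto (fun ζ => p.eval ζ / ζ ^ p.natDegree) (cobounded ℂ) (𝓝 p.leadingCoeff) := by
  have h1 : Tendsto (fun ζ : ℂ => p.reverse.eval ζ⁻¹) (cobounded ℂ) (𝓝 p.leadingCoeff) := by
    have h2 := (p.reverse.continuous.tendsto 0).comp (tendsto_inv₀_cobounded (α := ℂ))
    rwa [← Polynomial.coeff_zero_eq_eval_zero, Polynomial.coeff_zero_reverse] at h2
  refine h1.congr' ?_
  filter_upwards [eventually_ne_cobounded (0 : ℂ)] with ζ hζ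
  have := invertibleOfNonzero hζ
  have h3 := Polynomial.eval₂_reverse_mul_pow (RingHom.id ℂ) ζ p
  rw [invOf_eq_inv, ← Polynomial.eval, ← Polynomial.eval] at h3
  rw [← h3, mul_div_cancel_right₀ _ (pow_ne_zero _ hζ)]

/-- If `w = ζ exp(ζ / μ)` then `log |w| = log |ζ| + Re ζ / μ`. -/
theorem log_norm_mul_exp {μ : ℝ} {ζ : ℂ} (hζ : ζ ≠ 0) :
    Real.log ‖ζ * Complex.exp (ζ / μ)‖ = Real.log ‖ζ‖ + ζ.re / μ := by
  rw [norm_mul, Complex.norm_exp, Real.log_mul (norm_ne_zero_iff.2 hζ) (Real.exp_ne_zero _),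
    Real.log_exp, Complex.div_ofReal_re]

/-- Where `ζ` is large and `ζ exp(ζ / μ)` has a nonzero limit `w`, only the terms on the line of
slope `μ` survive in the normalized exponential polynomial. -/
theorem tendsto_expPoly_div {ι : Type*} {l : Filter ι} {F : Finset ℝ} {P : ℝ → ℂ[X]}
    {μ β₀ : ℝ} (hμ : 0 < μ)
    (hle : ∀ β ∈ F, ((P β).natDegree : ℝ) ≤ (P β₀).natDegree + μ * (β - β₀))
    (hge : ∀ β ∈ F, ((P β).natDegree : ℝ) = (P β₀).natDegree + μ * (β - β₀) → β₀ ≤ β)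
    {ζ : ι → ℂ} (hζ : Tendsto ζ l (cobounded ℂ)) {w : ℂ} (hw : w ≠ 0)
    (hZ : Tendsto (fun i => ζ i * Complex.exp (ζ i / μ)) l (𝓝 w)) :
    Tendsto (fun i => expPoly F P (ζ i) /
        (ζ i ^ (P β₀).natDegree * Complex.exp ((β₀ : ℂ) * ζ i))) l
      (𝓝 ((edgePoly F P μ β₀).eval w)) := by
  have hterm : ∀ β ∈ F, Tendsto (fun i => (P β).eval (ζ i) / ζ i ^ (P β).natDegree *
      (ζ i ^ (P β).natDegree * Complex.exp ((β : ℂ) * ζ i) /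
        (ζ i ^ (P β₀).natDegree * Complex.exp ((β₀ : ℂ) * ζ i)))) l
      (𝓝 (if ((P β).natDegree : ℝ) = (P β₀).natDegree + μ * (β - β₀) then
        (P β).leadingCoeff * w ^ ((P β).natDegree - (P β₀).natDegree) else 0)) := by
    intro β hβ
    have h1 := (tendsto_eval_div_pow_natDegree (P β)).comp hζ
    split_ifs with hon
    · refine h1.mul ((hZ.pow ((P β).natDegree - (P β₀).natDegree)).congr' ?_)
      filter_upwards [hζ.eventually (eventually_ne_cobounded 0)] with i hi
      have hge' := hge β hβ hon
      have hdeg : (P β₀).natDegree ≤ (P β).natDegree := by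
        have : ((P β₀).natDegree : ℝ) ≤ (P β).natDegree := by
          rw [hon]; nlinarith [mul_nonneg hμ.le (sub_nonneg.2 hge')]
        exact_mod_cast this
      obtain ⟨p, hp⟩ := Nat.exists_eq_add_of_le hdeg
      have hp' : (p : ℝ) = μ * (β - β₀) := by
        rw [hp] at hon; push_cast at hon; linarith
      have hexp : Complex.exp ((β : ℂ) * ζ i) =
          Complex.exp (ζ i / μ) ^ p * Complex.exp ((β₀ : ℂ) * ζ i) := by
        rw [← Complex.exp_nat_mul, ← Complex.exp_add]
        congr 1
        have hμ' : (μ : ℂ) ≠ 0 := Complex.ofReal_ne_zero.2 hμ.ne'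
        have : (p : ℂ) = μ * (β - β₀) := by exact_mod_cast hp'
        rw [this]; field_simp; ring
      rw [hexp, hp, Nat.add_sub_cancel_left, mul_pow, pow_add]
      have h2 := Complex.exp_ne_zero ((β₀ : ℂ) * ζ i)
      have h3 := pow_ne_zero (P β₀).natDegree hi
      field_simp
    · rw [← mul_zero ((P β).leadingCoeff)]
      refine h1.mul (tendsto_zero_iff_norm_tendsto_zero.2 ?_)
      have hlt : ((P β).natDegree : ℝ) - (P β₀).natDegree - μ * (β - β₀) < 0 := by
        have := lt_of_le_of_ne (hle β hβ) hon
        linarith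
      have hL : Tendsto (fun i => Real.log ‖ζ i‖) l atTop :=
        Real.tendsto_log_atTop.comp (tendsto_norm_cobounded_atTop.comp hζ)
      have hlog : Tendsto (fun i => Real.log ‖ζ i * Complex.exp (ζ i / μ)‖) l
          (𝓝 (Real.log ‖w‖)) := hZ.norm.log (norm_ne_zero_iff.2 hw)
      have hE := (hL.const_mul_atTop_of_neg hlt).atBot_add (hlog.const_mul (μ * (β - β₀)))
      refine (Real.tendsto_exp_atBot.comp hE).congr' ?_
      filter_upwards [hζ.eventually (eventually_ne_cobounded 0)] with i hi
      have hpos : 0 < ‖ζ i‖ := norm_pos_iff.2 hi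
      simp only [Function.comp, norm_div, norm_mul, norm_pow, Complex.norm_exp,
        Complex.re_ofReal_mul]
      have hlogw := log_norm_mul_exp (μ := μ) hi
      rw [norm_mul, Complex.norm_exp] at hlogw
      rw [hlogw]
      have hpow : ∀ n : ℕ, ‖ζ i‖ ^ n = Real.exp (n * Real.log ‖ζ i‖) := fun n => by
        rw [Real.exp_nat_mul, Real.exp_log hpos]
      rw [hpow, hpow, ← Real.exp_add, ← Real.exp_add, ← Real.exp_sub]
      congr 1
      field_simp
      ring
  have hsum := tendsto_finsetSum F hterm
  rw [edgePoly, Polynomial.eval_finsetSum, Finset.sum_filter]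
  simp only [Polynomial.eval_mul, Polynomial.eval_C, Polynomial.eval_pow, Polynomial.eval_X]
  refine hsum.congr' ?_
  filter_upwards [hζ.eventually (eventually_ne_cobounded 0)] with i hi
  rw [expPoly, Finset.sum_div]
  refine Finset.sum_congr rfl fun β _ => ?_
  have h3 := pow_ne_zero (P β).natDegree hi
  field_simp

theorem tendsto_log_div_cobounded :
    Tendsto (fun w : ℂ => Complex.log w / w) (cobounded ℂ) (𝓝 0) := by
  have h1 : Tendsto (fun w : ℂ => Real.log ‖w‖ / ‖w‖ + Real.pi / ‖w‖) (cobounded ℂ) (𝓝 0) := by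
    have h2 := Real.isLittleO_log_id_atTop.tendsto_div_nhds_zero.comp
      (tendsto_norm_cobounded_atTop (E := ℂ))
    have h3 := (tendsto_norm_cobounded_atTop (E := ℂ)).const_div_atTop Real.pi
    simpa using h2.add h3
  refine squeeze_zero_norm' ?_ h1
  have h4 := (tendsto_norm_cobounded_atTop (E := ℂ)).eventually_ge_atTop 1
  filter_upwards [h4] with w hw
  rw [norm_div, ← add_div]
  gcongr
  refine (Complex.norm_le_abs_re_add_abs_im _).trans ?_
  rw [Complex.log_re, Complex.log_im, abs_of_nonneg (Real.log_nonneg hw)]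
  gcongr
  exact Complex.abs_arg_le_pi _

/-! ### The approximate zeros -/

/-- The `k`-th approximate solution of the equation `ζ exp(ζ / μ) = ρ`: in
`s = 2 π i k + Log ρ - Log μ - Log s`, where `s = ζ / μ`, the last `s` is replaced by `2 π i k`.
Only large `|k|` matter. -/
noncomputable def centre (μ : ℝ) (ρ : ℂ) (k : ℤ) : ℂ :=
  μ * (2 * Real.pi * Complex.I * k - Complex.log (2 * Real.pi * Complex.I * k) +
    Complex.log ρ - Complex.log μ)

theorem two_pi_I_mul_int_ne_zero {k : ℤ} (hk : k ≠ 0) : (2 * Real.pi * Complex.I * k : ℂ) ≠ 0 :=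
  mul_ne_zero Complex.two_pi_I_ne_zero (Int.cast_ne_zero.2 hk)

theorem tendsto_two_pi_I_mul_int :
    Tendsto (fun k : ℤ => (2 * Real.pi * Complex.I * k : ℂ)) cofinite (cobounded ℂ) := by
  rw [← tendsto_norm_atTop_iff_cobounded]
  have h1 : Tendsto (fun k : ℤ => ‖(k : ℝ)‖) cofinite atTop :=
    tendsto_norm_cocompact_atTop.comp Int.tendsto_coe_cofinite
  have h2 := h1.const_mul_atTop Real.two_pi_pos
  refine h2.congr fun k => ?_
  simp [abs_of_pos Real.pi_pos]

theorem tendsto_centre_div (μ : ℝ) (hμ : 0 < μ) (ρ : ℂ) :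
    Tendsto (fun k => centre μ ρ k / (μ * (2 * Real.pi * Complex.I * k))) cofinite (𝓝 1) := by
  have h1 := tendsto_log_div_cobounded.comp tendsto_two_pi_I_mul_int
  have h2 := (tendsto_inv₀_cobounded (α := ℂ)).comp tendsto_two_pi_I_mul_int
  have h3 := ((tendsto_const_nhds (x := (1 : ℂ))).sub h1).add
    (h2.const_mul (Complex.log ρ - Complex.log μ))
  rw [mul_zero, sub_zero, add_zero] at h3
  refine h3.congr' ?_
  filter_upwards [eventually_cofinite_ne 0] with k hk
  have hk' := two_pi_I_mul_int_ne_zero hk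
  have hμ' : (μ : ℂ) ≠ 0 := Complex.ofReal_ne_zero.2 hμ.ne'
  simp only [Function.comp, centre]
  rw [mul_div_mul_left _ _ hμ', add_sub_assoc, add_div, sub_div, div_self hk']
  ring

theorem tendsto_centre {μ : ℝ} (hμ : 0 < μ) (ρ : ℂ) :
    Tendsto (centre μ ρ) cofinite (cobounded ℂ) := by
  rw [← tendsto_norm_atTop_iff_cobounded]
  have h1 := tendsto_norm_cobounded_atTop.comp tendsto_two_pi_I_mul_int
  have h2 := (h1.const_mul_atTop hμ).atTop_mul_pos (by norm_num) (tendsto_centre_div μ hμ ρ).norm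
  refine h2.congr' ?_
  filter_upwards [eventually_cofinite_ne 0] with k hk
  have hk' := two_pi_I_mul_int_ne_zero hk
  have hμ' : (μ : ℂ) ≠ 0 := Complex.ofReal_ne_zero.2 hμ.ne'
  have h3 : μ * ‖(2 * Real.pi * Complex.I * k : ℂ)‖ =
      ‖(μ * (2 * Real.pi * Complex.I * k) : ℂ)‖ := by
    rw [norm_mul (μ : ℂ), Complex.norm_real, Real.norm_of_nonneg hμ.le]
  simp only [Function.comp]
  rw [h3, ← norm_mul, mul_div_cancel₀ _ (mul_ne_zero hμ' hk')]

/-- Near the approximate zeros, `ζ exp(ζ / μ)` is close to `ρ exp(v / μ)`, where `v` is the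
displacement from the approximate zero. -/
theorem tendsto_centre_add_mul_exp {ι : Type*} {l : Filter ι} {μ : ℝ} (hμ : 0 < μ) {ρ : ℂ}
    (hρ : ρ ≠ 0) {k : ι → ℤ} {v : ι → ℂ} {v₀ : ℂ} (hk : Tendsto k l cofinite)
    (hv : Tendsto v l (𝓝 v₀)) :
    Tendsto (fun i => (centre μ ρ (k i) + v i) * Complex.exp ((centre μ ρ (k i) + v i) / μ)) l
      (𝓝 (ρ * Complex.exp (v₀ / μ))) := by
  have hμ' : (μ : ℂ) ≠ 0 := Complex.ofReal_ne_zero.2 hμ.ne'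
  have h2 := (tendsto_inv₀_cobounded (α := ℂ)).comp (tendsto_two_pi_I_mul_int.comp hk)
  have h3 := ((tendsto_centre_div μ hμ ρ).comp hk).add ((hv.mul h2).div_const (μ : ℂ))
  have h4 := h3.mul (((hv.div_const (μ : ℂ)).cexp).const_mul ρ)
  rw [mul_zero, zero_div, add_zero, one_mul] at h4
  refine h4.congr' ?_
  filter_upwards [hk.eventually (eventually_cofinite_ne 0)] with i hi
  have hk' := two_pi_I_mul_int_ne_zero hi
  have hexp : Complex.exp ((centre μ ρ (k i) + v i) / μ) =
      ρ / (μ * (2 * Real.pi * Complex.I * k i)) * Complex.exp (v i / μ) := by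
    rw [add_div, Complex.exp_add, centre, mul_div_cancel_left₀ _ hμ', Complex.exp_sub,
      Complex.exp_add, Complex.exp_sub, Complex.exp_log hk', Complex.exp_log hρ,
      Complex.exp_log hμ', show (2 * Real.pi * Complex.I * k i : ℂ) =
        k i * (2 * Real.pi * Complex.I) by ring, Complex.exp_int_mul_two_pi_mul_I]
    congr 1
    field_simp
  rw [hexp]
  simp only [Function.comp]
  field_simp

/-- Conversely, where `ζ` is large and `ζ exp(ζ / μ)` is close to `ρ`, the point `ζ` is close to
one of the approximate zeros. -/
theorem exists_tendsto_sub_centre {l : Filter ℂ} {μ : ℝ} (hμ : 0 < μ) {ρ : ℂ} (hρ : ρ ≠ 0)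
    (hl : l ≤ cobounded ℂ) (hZ : Tendsto (fun ζ : ℂ => ζ * Complex.exp (ζ / μ)) l (𝓝 ρ)) :
    ∃ k : ℂ → ℤ, Tendsto (fun ζ => ζ - centre μ ρ (k ζ)) l (𝓝 0) := by
  have hμ' : (μ : ℂ) ≠ 0 := Complex.ofReal_ne_zero.2 hμ.ne'
  have hid : Tendsto (fun ζ : ℂ => ζ) l (cobounded ℂ) := hl
  set Z : ℂ → ℂ := fun ζ => ζ * Complex.exp (ζ / μ) with hZdef
  have hs : Tendsto (fun ζ : ℂ => ζ / μ) l (cobounded ℂ) := by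
    rw [← tendsto_norm_atTop_iff_cobounded]
    refine ((tendsto_norm_cobounded_atTop.comp hid).atTop_div_const hμ).congr fun ζ => ?_
    simp [abs_of_pos hμ]
  have hlogZ : Tendsto (fun ζ => Complex.log (Z ζ / ρ)) l (𝓝 0) := by
    have h1 := hZ.div_const ρ
    rw [div_self hρ] at h1
    simpa using h1.clog (by simp)
  have hex : ∀ ζ : ℂ, ∃ k : ℤ, ζ ≠ 0 → ζ / μ + Complex.log (ζ / μ) - Complex.log ρ + Complex.log μ =
      Complex.log (Z ζ / ρ) + k * (2 * Real.pi * Complex.I) := fun ζ => by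
    by_cases hζ : ζ = 0
    · exact ⟨0, fun h => absurd hζ h⟩
    · have h1 : Complex.exp (ζ / μ + Complex.log (ζ / μ) - Complex.log ρ + Complex.log μ) =
          Complex.exp (Complex.log (Z ζ / ρ)) := by
        rw [Complex.exp_add, Complex.exp_sub, Complex.exp_add, Complex.exp_log (div_ne_zero hζ hμ'),
          Complex.exp_log hρ, Complex.exp_log hμ', Complex.exp_log
            (div_ne_zero (mul_ne_zero hζ (Complex.exp_ne_zero _)) hρ)]
        field_simp
      obtain ⟨k, hk⟩ := Complex.exp_eq_exp_iff_exists_int.1 h1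
      exact ⟨k, fun _ => hk⟩
  choose k hk using hex
  refine ⟨k, ?_⟩
  have hne : ∀ᶠ ζ in l, ζ ≠ 0 := hid.eventually (eventually_ne_cobounded 0)
  set a : ℂ → ℂ := fun ζ => 2 * Real.pi * Complex.I * k ζ with ha
  have has : Tendsto (fun ζ => a ζ / (ζ / μ)) l (𝓝 1) := by
    have h1 := tendsto_log_div_cobounded.comp hs
    have h2 := (tendsto_inv₀_cobounded (α := ℂ)).comp hs
    have h3 := ((tendsto_const_nhds (x := (1 : ℂ))).add h1).add
      (((tendsto_const_nhds (x := -Complex.log ρ + Complex.log μ)).sub hlogZ).mul h2)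
    rw [mul_zero, add_zero, add_zero] at h3
    refine h3.congr' ?_
    filter_upwards [hne] with ζ hζ
    have h4 : a ζ = ζ / μ + Complex.log (ζ / μ) - Complex.log ρ + Complex.log μ -
        Complex.log (Z ζ / ρ) := by rw [hk ζ hζ, ha]; ring
    have h5 := div_ne_zero hζ hμ'
    simp only [Function.comp]
    rw [h4, eq_div_iff h5]
    generalize ζ / (μ : ℂ) = s at h5 ⊢
    field_simp
    ring
  have hsa : Tendsto (fun ζ => ζ / μ / a ζ) l (𝓝 1) := by
    simpa using has.inv₀ one_ne_zero
  have hlog : Tendsto (fun ζ => Complex.log (ζ / μ / a ζ)) l (𝓝 0) := by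
    simpa using hsa.clog (by simp)
  have hlim := hlogZ.sub hlog
  rw [sub_zero] at hlim
  have hlim' := hlim.const_mul (μ : ℂ)
  rw [mul_zero] at hlim'
  refine hlim'.congr' ?_
  have hre : ∀ᶠ ζ in l, 0 < (ζ / μ / a ζ).re :=
    (Complex.continuous_re.continuousAt.tendsto.comp hsa).eventually_const_lt (by simp)
  filter_upwards [hne, hre] with ζ hζ hζre
  have ha0 : a ζ ≠ 0 := fun h => by simp [h] at hζre
  -- `a ζ` is purely imaginary, so the two arguments add up to an angle inside `(-π, π)`
  have hmul : Complex.log (ζ / μ) = Complex.log (a ζ) + Complex.log (ζ / μ / a ζ) := by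
    have h1 : ζ / μ = a ζ * (ζ / μ / a ζ) := by field_simp
    have h2 : |(a ζ).arg| ≤ Real.pi / 2 := by
      rw [Complex.abs_arg_le_pi_div_two_iff, ha]
      simp
    have h3 : |(ζ / μ / a ζ).arg| < Real.pi / 2 :=
      Complex.abs_arg_lt_pi_div_two_iff.2 (Or.inl hζre)
    conv_lhs => rw [h1]
    refine (Complex.log_mul_eq_add_log_iff ha0 fun h => by simp [h] at hζre).2 ⟨?_, ?_⟩
    · linarith [(abs_le.1 h2).1, (abs_lt.1 h3).1]
    · linarith [(abs_le.1 h2).2, (abs_lt.1 h3).2]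
  have h4 := hk ζ hζ
  have h6 : a ζ = k ζ * (2 * Real.pi * Complex.I) := by rw [ha]; ring
  have h5 : ζ - centre μ ρ (k ζ) =
      μ * (ζ / μ - (a ζ - Complex.log (a ζ) + Complex.log ρ - Complex.log μ)) := by
    rw [mul_sub, mul_div_cancel₀ _ hμ', centre, ha]
  rw [← h6, hmul] at h4
  rw [h5]
  linear_combination -(μ : ℂ) * h4

/-! ### The polynomial of a segment -/

section Edge

variable {F : Finset ℝ} {P : ℝ → ℂ[X]} {M : ℕ} {b : Fin (M + 1) → ℝ}

theorem IsUpperHull.vertex_le_of_on_line {h : ℝ → ℝ} (hb : IsUpperHull F h b) (n : Fin M)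
    {β : ℝ} (hβ : β ∈ F) (hon : h β =
      h (b n.castSucc) + chordSlope h (b n.castSucc) (b n.succ) * (β - b n.castSucc)) :
    b n.castSucc ≤ β ∧ β ≤ b n.succ := by
  constructor
  · by_contra! hlt
    exact (hb.lt_line n β hβ (Or.inl hlt)).ne hon
  · by_contra! hlt
    exact (hb.lt_line n β hβ (Or.inr hlt)).ne hon

theorem coeff_edgePoly {μ β₀ : ℝ} (hμ : 0 < μ)
    (hge : ∀ β ∈ F, ((P β).natDegree : ℝ) = (P β₀).natDegree + μ * (β - β₀) → β₀ ≤ β)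
    {β₁ : ℝ} (h₁ : β₁ ∈ F)
    (hon : ((P β₁).natDegree : ℝ) = (P β₀).natDegree + μ * (β₁ - β₀)) :
    (edgePoly F P μ β₀).coeff ((P β₁).natDegree - (P β₀).natDegree) = (P β₁).leadingCoeff := by
  have hcast : ∀ β ∈ F, ((P β).natDegree : ℝ) = (P β₀).natDegree + μ * (β - β₀) →
      (((P β).natDegree - (P β₀).natDegree : ℕ) : ℝ) = μ * (β - β₀) := fun β hβ h => by
    have h1 := mul_nonneg hμ.le (sub_nonneg.2 (hge β hβ h))
    rw [Nat.cast_sub (by exact_mod_cast (by linarith :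
      ((P β₀).natDegree : ℝ) ≤ (P β).natDegree)), h]
    ring
  rw [edgePoly, Polynomial.finsetSum_coeff, Finset.sum_eq_single β₁]
  · simp
  · intro β hβ hne
    rw [Finset.mem_filter] at hβ
    rw [Polynomial.coeff_C_mul_X_pow, if_neg]
    intro he
    have h2 := hcast β hβ.1 hβ.2
    rw [← he, hcast β₁ h₁ hon] at h2
    exact hne (by have := mul_left_cancel₀ hμ.ne' h2; linarith)
  · exact fun h => absurd (Finset.mem_filter.2 ⟨h₁, hon⟩) h

theorem natDegree_edgePoly (hP : ∀ β ∈ F, P β ≠ 0)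
    (hb : IsUpperHull F (fun β => ((P β).natDegree : ℝ)) b) (n : Fin M)
    (hμ : 0 < chordSlope (fun β => ((P β).natDegree : ℝ)) (b n.castSucc) (b n.succ)) :
    (edgePoly F P (chordSlope (fun β => ((P β).natDegree : ℝ)) (b n.castSucc) (b n.succ))
      (b n.castSucc)).natDegree = (P (b n.succ)).natDegree - (P (b n.castSucc)).natDegree := by
  have hlt : b n.castSucc < b n.succ := hb.strictMono Fin.castSucc_lt_succ
  refine Polynomial.natDegree_eq_of_le_of_coeff_ne_zero ?_ ?_
  · refine Polynomial.natDegree_sum_le_of_forall_le _ _ fun β hβ => ?_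
    rw [Finset.mem_filter] at hβ
    refine (Polynomial.natDegree_C_mul_X_pow_le _ _).trans (Nat.sub_le_sub_right ?_ _)
    have h1 := (hb.vertex_le_of_on_line n hβ.1 hβ.2).2
    have h2 := add_chordSlope_mul (fun β => ((P β).natDegree : ℝ)) hlt.ne
    have h3 : ((P β).natDegree : ℝ) ≤ (P (b n.succ)).natDegree := by
      rw [hβ.2, ← h2]
      gcongr
    exact_mod_cast h3
  · rw [coeff_edgePoly hμ (fun β hβ h => (hb.vertex_le_of_on_line n hβ h).1) (hb.mem n.succ)]
    · exact Polynomial.leadingCoeff_ne_zero.2 (hP _ (hb.mem _))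
    · exact (add_chordSlope_mul (fun β => ((P β).natDegree : ℝ)) hlt.ne).symm

theorem eval_zero_edgePoly_ne_zero (hP : ∀ β ∈ F, P β ≠ 0)
    (hb : IsUpperHull F (fun β => ((P β).natDegree : ℝ)) b) (n : Fin M)
    (hμ : 0 < chordSlope (fun β => ((P β).natDegree : ℝ)) (b n.castSucc) (b n.succ)) :
    (edgePoly F P (chordSlope (fun β => ((P β).natDegree : ℝ)) (b n.castSucc) (b n.succ))
      (b n.castSucc)).eval 0 ≠ 0 := by
  rw [← Polynomial.coeff_zero_eq_eval_zero]
  have h1 := coeff_edgePoly hμ (fun β hβ h => (hb.vertex_le_of_on_line n hβ h).1)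
    (hb.mem n.castSucc) (by ring)
  rw [Nat.sub_self] at h1
  rw [h1]
  exact Polynomial.leadingCoeff_ne_zero.2 (hP _ (hb.mem _))

end Edge

/-! ### Localization of the large zeros -/

/-- Large zeros of an exponential polynomial lie in the curvilinear strips in which
`|ζ exp(ζ / μ)|` is bounded and bounded away from zero, with `μ` the slope of a segment: outside
of these strips one term dominates all the others. -/
theorem exists_slope_eventually_log_le {F : Finset ℝ} {P : ℝ → ℂ[X]} (hP : ∀ β ∈ F, P β ≠ 0)
    {M : ℕ} {b : Fin (M + 1) → ℝ} (hb : IsUpperHull F (fun β => ((P β).natDegree : ℝ)) b)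
    (hμ : ∀ n : Fin M,
      0 < chordSlope (fun β => ((P β).natDegree : ℝ)) (b n.castSucc) (b n.succ))
    (U : Ultrafilter ℂ) (hU : (U : Filter ℂ) ≤ cobounded ℂ)
    (hzero : ∀ᶠ ζ in (U : Filter ℂ), expPoly F P ζ = 0) :
    ∃ (n : Fin M) (C : ℝ), ∀ᶠ ζ : ℂ in (U : Filter ℂ),
      |Real.log ‖ζ * Complex.exp (ζ / (chordSlope (fun β => ((P β).natDegree : ℝ))
        (b n.castSucc) (b n.succ) : ℝ))‖| ≤ C := by
  set E : ℝ → ℂ → ℝ := fun β ζ => (P β).natDegree * Real.log ‖ζ‖ + β * ζ.re with hE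
  have hne : ∀ᶠ ζ in (U : Filter ℂ), ζ ≠ 0 := hU (eventually_ne_cobounded 0)
  have hL : Tendsto (fun ζ : ℂ => Real.log ‖ζ‖) U atTop :=
    Real.tendsto_log_atTop.comp (tendsto_norm_cobounded_atTop.mono_left hU)
  -- a dominating term
  obtain ⟨β₀, hβ₀, hmax⟩ : ∃ β₀ ∈ F, ∀ᶠ ζ in (U : Filter ℂ), ∀ β ∈ F, E β ζ ≤ E β₀ ζ := by
    refine (Ultrafilter.eventually_exists_mem_iff (Finset.finite_toSet F)).1 ?_
    refine Eventually.of_forall fun ζ => ?_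
    exact F.exists_max_image (fun β => E β ζ) ⟨b 0, hb.mem 0⟩
  have hquot : ∀ β ζ, ζ ≠ 0 →
      ‖ζ ^ (P β).natDegree * Complex.exp ((β : ℂ) * ζ) /
        (ζ ^ (P β₀).natDegree * Complex.exp ((β₀ : ℂ) * ζ))‖ = Real.exp (E β ζ - E β₀ ζ) := by
    intro β ζ hζ
    have hpos : 0 < ‖ζ‖ := norm_pos_iff.2 hζ
    have hpow : ∀ n : ℕ, ‖ζ‖ ^ n = Real.exp (n * Real.log ‖ζ‖) := fun n => by
      rw [Real.exp_nat_mul, Real.exp_log hpos]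
    simp only [norm_div, norm_mul, norm_pow, Complex.norm_exp, Complex.re_ofReal_mul]
    rw [hpow, hpow, ← Real.exp_add, ← Real.exp_add, ← Real.exp_sub]
  -- a second term of comparable size
  obtain ⟨β₁, hβ₁, hne01, C, hC⟩ : ∃ β₁ ∈ F, β₁ ≠ β₀ ∧ ∃ C, ∀ᶠ ζ in (U : Filter ℂ),
      -C ≤ E β₁ ζ - E β₀ ζ := by
    by_contra! hcon
    have hterm : ∀ β ∈ F, Tendsto (fun ζ => (P β).eval ζ / ζ ^ (P β).natDegree *
        (ζ ^ (P β).natDegree * Complex.exp ((β : ℂ) * ζ) /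
          (ζ ^ (P β₀).natDegree * Complex.exp ((β₀ : ℂ) * ζ)))) U
        (𝓝 (if β = β₀ then (P β).leadingCoeff else 0)) := by
      intro β hβ
      have h1 := (tendsto_eval_div_pow_natDegree (P β)).mono_left hU
      split_ifs with h
      · subst h
        rw [← mul_one (P β).leadingCoeff]
        refine h1.mul (tendsto_const_nhds.congr' ?_)
        filter_upwards [hne] with ζ hζ
        rw [div_self (mul_ne_zero (pow_ne_zero _ hζ) (Complex.exp_ne_zero _))]
      · rw [← mul_zero (P β).leadingCoeff]
        refine h1.mul (tendsto_zero_iff_norm_tendsto_zero.2 ?_)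
        have h2 : Tendsto (fun ζ => E β ζ - E β₀ ζ) U atBot := by
          refine tendsto_atBot.2 fun c => ?_
          have h3 := hcon β hβ h (-c)
          filter_upwards [h3] with ζ hζ
          linarith
        refine (Real.tendsto_exp_atBot.comp h2).congr' ?_
        filter_upwards [hne] with ζ hζ
        exact (hquot β ζ hζ).symm
    have hsum := tendsto_finsetSum F hterm
    rw [Finset.sum_ite_eq' F β₀, if_pos hβ₀] at hsum
    refine Polynomial.leadingCoeff_ne_zero.2 (hP _ hβ₀) (tendsto_nhds_unique hsum ?_)
    refine tendsto_const_nhds.congr' ?_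
    filter_upwards [hne, hzero] with ζ hζ h0
    have h4 : ∑ β ∈ F, (P β).eval ζ / ζ ^ (P β).natDegree *
        (ζ ^ (P β).natDegree * Complex.exp ((β : ℂ) * ζ) /
          (ζ ^ (P β₀).natDegree * Complex.exp ((β₀ : ℂ) * ζ))) =
        expPoly F P ζ / (ζ ^ (P β₀).natDegree * Complex.exp ((β₀ : ℂ) * ζ)) := by
      rw [expPoly, Finset.sum_div]
      refine Finset.sum_congr rfl fun β _ => ?_
      have h3 := pow_ne_zero (P β).natDegree hζ
      field_simp
    rw [h4, h0, zero_div]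
  -- the two terms determine the slope of a supporting line
  set s : ℝ := (((P β₁).natDegree : ℝ) - (P β₀).natDegree) / (β₁ - β₀) with hs
  have hδ : β₁ - β₀ ≠ 0 := sub_ne_zero.2 hne01
  have hsδ : s * (β₁ - β₀) = ((P β₁).natDegree : ℝ) - (P β₀).natDegree := by
    rw [hs, div_mul_cancel₀ _ hδ]
  have hbd : ∀ᶠ ζ : ℂ in (U : Filter ℂ), |s * Real.log ‖ζ‖ + ζ.re| ≤ C / |β₁ - β₀| := by
    filter_upwards [hC, hmax] with ζ h1 h2
    rw [le_div_iff₀ (abs_pos.2 hδ), ← abs_mul]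
    have h3 : (s * Real.log ‖ζ‖ + ζ.re) * (β₁ - β₀) = E β₁ ζ - E β₀ ζ := by
      rw [hE]; linear_combination Real.log ‖ζ‖ * hsδ
    rw [h3, abs_le]
    exact ⟨h1, by linarith [h2 β₁ hβ₁, (by linarith [h2 β₁ hβ₁] : 0 ≤ C)]⟩
  have hsup : ∀ β ∈ F, ((P β).natDegree : ℝ) ≤ (P β₀).natDegree + s * (β - β₀) := by
    intro β hβ
    by_contra! hlt
    have hpos : 0 < ((P β).natDegree : ℝ) - (P β₀).natDegree - s * (β - β₀) := by linarith
    have h1 := (hL.const_mul_atTop hpos).eventually_gt_atTop (|β - β₀| * (C / |β₁ - β₀|))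
    obtain ⟨ζ, h2, h3, h4⟩ := (h1.and (hmax.and hbd)).exists
    have h5 := h3 β hβ
    simp only [hE] at h5
    have h6 : -(|β - β₀| * (C / |β₁ - β₀|)) ≤ (β - β₀) * (s * Real.log ‖ζ‖ + ζ.re) := by
      refine neg_le_of_abs_le ?_
      rw [abs_mul]
      gcongr
    nlinarith
  obtain ⟨n, hn⟩ : ∃ n : Fin M,
      chordSlope (fun β => ((P β).natDegree : ℝ)) (b n.castSucc) (b n.succ) = s := by
    rcases lt_or_gt_of_ne hne01 with hlt | hlt
    · refine hb.exists_slope_eq hβ₁ hβ₀ hlt (by linarith) fun β hβ => ?_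
      have := hsup β hβ
      linarith
    · exact hb.exists_slope_eq hβ₀ hβ₁ hlt (by linarith) hsup
  have hspos : 0 < s := hn ▸ hμ n
  refine ⟨n, C / |β₁ - β₀| / s, ?_⟩
  filter_upwards [hbd, hne] with ζ h1 h2
  rw [hn, log_norm_mul_exp h2, le_div_iff₀ hspos]
  rw [← abs_of_pos hspos, ← abs_mul, abs_of_pos hspos]
  have : (Real.log ‖ζ‖ + ζ.re / s) * s = s * Real.log ‖ζ‖ + ζ.re := by field_simp
  rwa [this]

/-- Along an ultrafilter of large zeros, `ζ exp(ζ / μ)` converges to a root of the polynomial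
of a segment, with `μ` the slope of the segment. -/
theorem exists_slope_root_tendsto {F : Finset ℝ} {P : ℝ → ℂ[X]} (hP : ∀ β ∈ F, P β ≠ 0)
    {M : ℕ} {b : Fin (M + 1) → ℝ} (hb : IsUpperHull F (fun β => ((P β).natDegree : ℝ)) b)
    {μ : Fin M → ℝ} (hμ : ∀ n, 0 < μ n)
    (hslope : ∀ n,
      μ n = chordSlope (fun β => ((P β).natDegree : ℝ)) (b n.castSucc) (b n.succ))
    (U : Ultrafilter ℂ) (hU : (U : Filter ℂ) ≤ cobounded ℂ)
    (hzero : ∀ᶠ ζ in (U : Filter ℂ), expPoly F P ζ = 0) :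
    ∃ (n : Fin M) (ρ : ℂ), (edgePoly F P (μ n) (b n.castSucc)).eval ρ = 0 ∧
      Tendsto (fun ζ : ℂ => ζ * Complex.exp (ζ / μ n)) U (𝓝 ρ) := by
  obtain ⟨n, C, hC⟩ := exists_slope_eventually_log_le hP hb (fun n => hslope n ▸ hμ n) U hU hzero
  rw [← hslope n] at hC
  have hne : ∀ᶠ ζ in (U : Filter ℂ), ζ ≠ 0 := hU (eventually_ne_cobounded 0)
  have hbds : ∀ᶠ ζ : ℂ in (U : Filter ℂ),
      Real.exp (-C) ≤ ‖ζ * Complex.exp (ζ / μ n)‖ ∧ ‖ζ * Complex.exp (ζ / μ n)‖ ≤ Real.exp C := by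
    filter_upwards [hC, hne] with ζ h1 h2
    have hpos : 0 < ‖ζ * Complex.exp (ζ / μ n)‖ :=
      norm_pos_iff.2 (mul_ne_zero h2 (Complex.exp_ne_zero _))
    rw [← Real.le_log_iff_exp_le hpos, ← Real.log_le_iff_le_exp hpos]
    exact abs_le.1 h1
  obtain ⟨ρ, -, hρ⟩ := (isCompact_closedBall (0 : ℂ) (Real.exp C)).ultrafilter_le_nhds
    (U.map fun ζ : ℂ => ζ * Complex.exp (ζ / μ n)) (by
      rw [le_principal_iff, Ultrafilter.coe_map, mem_map]
      filter_upwards [hbds] with ζ h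
      simpa using h.2)
  have hZ : Tendsto (fun ζ : ℂ => ζ * Complex.exp (ζ / μ n)) U (𝓝 ρ) := hρ
  have hρ0 : ρ ≠ 0 := norm_pos_iff.1 ((Real.exp_pos (-C)).trans_le
    (ge_of_tendsto hZ.norm (hbds.mono fun ζ h => h.1)))
  refine ⟨n, ρ, ?_, hZ⟩
  have hlim := tendsto_expPoly_div (hμ n)
    (fun β hβ => hslope n ▸ hb.le_line n β hβ)
    (fun β hβ h => (hb.vertex_le_of_on_line n hβ (hslope n ▸ h)).1) (ζ := fun ζ => ζ) hU hρ0 hZ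
  refine tendsto_nhds_unique hlim (tendsto_const_nhds.congr' ?_)
  filter_upwards [hzero] with ζ h
  rw [h, zero_div]

/-! ### Zeros near the approximate zeros -/

theorem analyticOrderAt_eval_eq_rootMultiplicity {q : ℂ[X]} (hq : q ≠ 0) (ρ : ℂ) :
    analyticOrderAt (fun w => q.eval w) ρ = q.rootMultiplicity ρ := by
  obtain ⟨g, hg, hdvd⟩ := q.exists_eq_pow_rootMultiplicity_mul_and_not_dvd hq ρ
  refine ((q.differentiable.analyticAt ρ).analyticOrderAt_eq_natCast).2
    ⟨fun w => g.eval w, g.differentiable.analyticAt ρ, ?_, Eventually.of_forall fun w => ?_⟩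
  · rwa [Ne, ← Polynomial.IsRoot.def, ← Polynomial.dvd_iff_isRoot]
  · conv_lhs => rw [hg]
    simp

theorem analyticOrderAt_comp_const_add (f : ℂ → ℂ) (c v : ℂ) :
    analyticOrderAt (fun w => f (c + w)) v = analyticOrderAt f (c + v) :=
  analyticOrderAt_comp_of_deriv_ne_zero (f := f) (g := fun w => c + w) (by fun_prop) (by simp)

theorem analyticOrderAt_mul_const {f : ℂ → ℂ} (hf : Differentiable ℂ f) {a : ℂ} (ha : a ≠ 0)
    (v : ℂ) : analyticOrderAt (fun w => f w * a) v = analyticOrderAt f v := by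
  have h1 : (fun w => f w * a) = f * fun _ => a := rfl
  rw [h1, analyticOrderAt_mul (hf.analyticAt v) analyticAt_const,
    (analyticAt_const.analyticOrderAt_eq_zero).2 ha, add_zero]

theorem analyticOrderAt_eval_mul_exp {q : ℂ[X]} (hq : q ≠ 0) {μ : ℝ} (hμ : μ ≠ 0) {ρ : ℂ}
    (hρ : ρ ≠ 0) (β : ℝ) :
    analyticOrderAt (fun v : ℂ => q.eval (ρ * Complex.exp (v / μ)) * Complex.exp (β * v)) 0 =
      q.rootMultiplicity ρ := by
  have hμ' : (μ : ℂ) ≠ 0 := Complex.ofReal_ne_zero.2 hμ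
  have hd : HasDerivAt (fun v : ℂ => ρ * Complex.exp (v / μ)) (ρ * (1 * (1 / μ))) 0 := by
    have h1 := (((hasDerivAt_id (0 : ℂ)).div_const (μ : ℂ)).cexp).const_mul ρ
    simpa using h1
  have h2 := analyticOrderAt_comp_of_deriv_ne_zero (f := fun w => q.eval w)
    (g := fun v : ℂ => ρ * Complex.exp (v / μ)) (z₀ := 0) (by fun_prop)
    (by rw [hd.deriv]; simpa using ⟨hρ, hμ⟩)
  simp only [zero_div, Complex.exp_zero, mul_one] at h2
  rw [analyticOrderAt_eval_eq_rootMultiplicity hq] at h2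
  have h3 : AnalyticAt ℂ (fun v : ℂ => Complex.exp (β * v)) 0 := by fun_prop
  have h4 : AnalyticAt ℂ ((fun w => q.eval w) ∘ fun v : ℂ => ρ * Complex.exp (v / μ)) 0 := by
    refine AnalyticAt.comp (q.differentiable.analyticAt _) (by fun_prop)
  have h5 := analyticOrderAt_mul h4 h3
  rw [h2, (h3.analyticOrderAt_eq_zero).2 (Complex.exp_ne_zero _), add_zero] at h5
  exact h5

/-- Around the approximate zeros that belong to `ρ`, the normalized exponential polynomial
converges, as a function of the displacement. -/
theorem tendstoLocallyUniformlyOn_expPoly {F : Finset ℝ} {P : ℝ → ℂ[X]} {μ β₀ : ℝ} (hμ : 0 < μ)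
    (hle : ∀ β ∈ F, ((P β).natDegree : ℝ) ≤ (P β₀).natDegree + μ * (β - β₀))
    (hge : ∀ β ∈ F, ((P β).natDegree : ℝ) = (P β₀).natDegree + μ * (β - β₀) → β₀ ≤ β)
    {ρ : ℂ} (hρ : ρ ≠ 0) :
    TendstoLocallyUniformlyOn
      (fun (k : ℤ) (v : ℂ) => expPoly F P (centre μ ρ k + v) *
        (centre μ ρ k ^ (P β₀).natDegree * Complex.exp ((β₀ : ℂ) * centre μ ρ k))⁻¹)
      (fun v => (edgePoly F P μ β₀).eval (ρ * Complex.exp (v / μ)) * Complex.exp (β₀ * v))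
      cofinite Set.univ := by
  rw [tendstoLocallyUniformlyOn_iff_forall_tendsto]
  intro x _
  rw [nhdsWithin_univ]
  have hk : Tendsto (fun y : ℤ × ℂ => y.1) (cofinite ×ˢ 𝓝 x) cofinite := tendsto_fst
  have hv : Tendsto (fun y : ℤ × ℂ => y.2) (cofinite ×ˢ 𝓝 x) (𝓝 x) := tendsto_snd
  have hc := (tendsto_centre hμ ρ).comp hk
  have hZ := tendsto_centre_add_mul_exp hμ hρ hk hv
  have hvc : Tendsto (fun y : ℤ × ℂ => y.2 / centre μ ρ y.1) (cofinite ×ˢ 𝓝 x) (𝓝 0) := by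
    simpa [div_eq_mul_inv] using! hv.mul ((tendsto_inv₀_cobounded (α := ℂ)).comp hc)
  have hcv : Tendsto (fun y : ℤ × ℂ => centre μ ρ y.1 + y.2) (cofinite ×ˢ 𝓝 x)
      (cobounded ℂ) := by
    rw [← tendsto_norm_atTop_iff_cobounded] at hc ⊢
    have h1 := hc.atTop_add hv.norm.neg
    refine tendsto_atTop_mono (fun y => ?_) h1
    have := norm_sub_le (centre μ ρ y.1 + y.2) y.2
    simp only [add_sub_cancel_right, Function.comp] at this ⊢
    linarith
  have hD := tendsto_expPoly_div hμ hle hge hcv (mul_ne_zero hρ (Complex.exp_ne_zero _)) hZ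
  have hlim := (hD.mul ((hvc.const_add 1).pow (P β₀).natDegree)).mul
    ((hv.const_mul (β₀ : ℂ)).cexp)
  rw [add_zero, one_pow, mul_one] at hlim
  have hlim' : Tendsto (fun y : ℤ × ℂ => expPoly F P (centre μ ρ y.1 + y.2) *
      (centre μ ρ y.1 ^ (P β₀).natDegree * Complex.exp ((β₀ : ℂ) * centre μ ρ y.1))⁻¹)
      (cofinite ×ˢ 𝓝 x)
      (𝓝 ((edgePoly F P μ β₀).eval (ρ * Complex.exp (x / μ)) * Complex.exp (β₀ * x))) := by
    refine hlim.congr' ?_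
    filter_upwards [hc.eventually (eventually_ne_cobounded 0),
      hcv.eventually (eventually_ne_cobounded 0)] with y h1 h2
    simp only [Function.comp] at h1
    have h3 := Complex.exp_ne_zero ((β₀ : ℂ) * centre μ ρ y.1)
    have h4 := Complex.exp_ne_zero ((β₀ : ℂ) * y.2)
    rw [mul_add, Complex.exp_add, one_add_div h1, div_pow]
    field_simp
  have hg : Tendsto (fun y : ℤ × ℂ => (edgePoly F P μ β₀).eval (ρ * Complex.exp (y.2 / μ)) *
      Complex.exp (β₀ * y.2)) (cofinite ×ˢ 𝓝 x)
      (𝓝 ((edgePoly F P μ β₀).eval (ρ * Complex.exp (x / μ)) * Complex.exp (β₀ * x))) := by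
    have h1 : Continuous fun v : ℂ => (edgePoly F P μ β₀).eval (ρ * Complex.exp (v / μ)) *
      Complex.exp (β₀ * v) := by fun_prop
    exact (h1.tendsto x).comp hv
  exact (hg.prodMk_nhds hlim').mono_right (nhds_le_uniformity _)

/-- In every small disc of fixed radius around the approximate zeros that belong to `ρ` there are,
far out, exactly as many zeros as the multiplicity of `ρ` says, and they approach the centre. -/
theorem eventually_zeros_near_centre {F : Finset ℝ} {P : ℝ → ℂ[X]} {μ β₀ : ℝ} (hμ : 0 < μ)
    (hle : ∀ β ∈ F, ((P β).natDegree : ℝ) ≤ (P β₀).natDegree + μ * (β - β₀))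
    (hge : ∀ β ∈ F, ((P β).natDegree : ℝ) = (P β₀).natDegree + μ * (β - β₀) → β₀ ≤ β)
    (hq : edgePoly F P μ β₀ ≠ 0) {ρ : ℂ} (hρ : ρ ≠ 0) :
    ∀ᶠ ε in 𝓝[>] (0 : ℝ),
      (∀ᶠ k : ℤ in cofinite, ∃ S : Multiset ℂ,
        S.card = (edgePoly F P μ β₀).rootMultiplicity ρ ∧
        (∀ s ∈ S, dist s (centre μ ρ k) ≤ ε) ∧
        ∀ ζ, dist ζ (centre μ ρ k) ≤ ε → analyticOrderAt (expPoly F P) ζ = S.count ζ) ∧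
      ∀ δ > 0, ∀ᶠ k : ℤ in cofinite, ∀ ζ, dist ζ (centre μ ρ k) ≤ ε → expPoly F P ζ = 0 →
        dist ζ (centre μ ρ k) < δ := by
  classical
  have hcg : (cofinite : Filter ℤ).IsCountablyGenerated := by
    rw [Int.cofinite_eq]; infer_instance
  set g : ℂ → ℂ := fun v =>
    (edgePoly F P μ β₀).eval (ρ * Complex.exp (v / μ)) * Complex.exp (β₀ * v) with hg
  have hgd : Differentiable ℂ g := by
    refine Differentiable.mul ?_ (by fun_prop)
    exact (edgePoly F P μ β₀).differentiable.comp (by fun_prop)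
  have hord := analyticOrderAt_eval_mul_exp hq hμ.ne' hρ β₀
  have hunif := tendstoLocallyUniformlyOn_expPoly hμ hle hge hρ
  have hisol : ∀ᶠ v in 𝓝[≠] (0 : ℂ), g v ≠ 0 := by
    rcases (hgd.analyticAt 0).eventually_eq_zero_or_eventually_ne_zero with h | h
    · rw [← analyticOrderAt_eq_top, hg, hord] at h
      exact absurd h (ENat.natCast_ne_top _)
    · exact h
  obtain ⟨r, hr, hr0⟩ := Metric.eventually_nhds_iff.1 (eventually_nhdsWithin_iff.1 hisol)
  filter_upwards [Ioo_mem_nhdsGT hr] with ε hε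
  have h0 : ∀ v ∈ closedBall (0 : ℂ) ε, v ≠ 0 → g v ≠ 0 := fun v hv hv0 =>
    hr0 ((mem_closedBall.1 hv).trans_lt hε.2) hv0
  have hfd : ∀ k : ℤ, Differentiable ℂ fun v : ℂ => expPoly F P (centre μ ρ k + v) *
      (centre μ ρ k ^ (P β₀).natDegree * Complex.exp ((β₀ : ℂ) * centre μ ρ k))⁻¹ := fun k =>
    ((differentiable_expPoly F P).comp (by fun_prop : Differentiable ℂ fun v : ℂ =>
      centre μ ρ k + v)).mul_const _
  have hne : ∀ᶠ k : ℤ in cofinite, centre μ ρ k ≠ 0 :=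
    (tendsto_centre hμ ρ).eventually (eventually_ne_cobounded 0)
  constructor
  · filter_upwards [eventually_exists_zeros_of_tendstoLocallyUniformly hfd hgd hunif hε.1 h0 hord,
      hne] with k hk hck
    obtain ⟨S, hcard, hS, hcount⟩ := hk
    refine ⟨S.map (centre μ ρ k + ·), by rw [Multiset.card_map, hcard], ?_, fun ζ hζ => ?_⟩
    · intro s hs
      obtain ⟨v, hv, rfl⟩ := Multiset.mem_map.1 hs
      have := mem_ball_zero_iff.1 (hS v hv)
      simpa [dist_eq_norm] using this.le
    · have hζ' : ζ - centre μ ρ k ∈ closedBall (0 : ℂ) ε := by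
        simpa [dist_eq_norm] using hζ
      have h1 := hcount _ hζ'
      have hcd : Differentiable ℂ fun v => expPoly F P (centre μ ρ k + v) :=
        (differentiable_expPoly F P).comp (by fun_prop)
      rw [analyticOrderAt_mul_const hcd
        (inv_ne_zero (mul_ne_zero (pow_ne_zero _ hck) (Complex.exp_ne_zero _)))] at h1
      have h2 := analyticOrderAt_comp_const_add (expPoly F P) (centre μ ρ k) (ζ - centre μ ρ k)
      rw [add_sub_cancel] at h2
      have h3 := Multiset.count_map_eq_count' (centre μ ρ k + ·) S (add_right_injective _)
        (ζ - centre μ ρ k)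
      simp only [add_sub_cancel] at h3
      rw [h3, ← h2]
      exact h1
  · intro δ hδ
    have hK : IsCompact (closedBall (0 : ℂ) ε \ ball 0 δ) :=
      (isCompact_closedBall 0 ε).diff isOpen_ball
    filter_upwards [eventually_ne_zero_of_tendstoLocallyUniformly hgd.continuous hunif hK
      fun v hv => h0 v hv.1 fun h => hv.2 (by simp [h, hδ])] with k hk ζ hζ hζ0
    by_contra! hge'
    refine hk (ζ - centre μ ρ k) ⟨by simpa [dist_eq_norm] using hζ, ?_⟩ ?_
    · simpa [dist_eq_norm] using hge'
    · rw [add_sub_cancel, hζ0, zero_mul]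

/-! ### Separation and exhaustion -/

theorem tendsto_cofinite_of_natAbs {ι : Type*} {l : Filter ι} {k : ι → ℤ}
    (h : Tendsto (fun i => (k i).natAbs) l atTop) : Tendsto k l cofinite := by
  rw [← Nat.cofinite_eq_atTop] at h
  exact (tendsto_comap_iff (g := Int.natAbs).2 h).mono_right (comap_cofinite_le _)

theorem le_dist_centre {μ : ℝ} (hμ : 0 < μ) (ρ : ℂ) {k k' : ℤ} (hne : k ≠ k') :
    μ * Real.pi ≤ dist (centre μ ρ k) (centre μ ρ k') := by
  have hre : ∀ j : ℤ, |Complex.arg (2 * Real.pi * Complex.I * j)| ≤ Real.pi / 2 := fun j => by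
    rw [Complex.abs_arg_le_pi_div_two_iff]; simp
  have him : (centre μ ρ k - centre μ ρ k').im = μ * (2 * Real.pi * (k - k') -
      (Complex.arg (2 * Real.pi * Complex.I * k) -
        Complex.arg (2 * Real.pi * Complex.I * k'))) := by
    rw [centre, centre, ← mul_sub, Complex.im_ofReal_mul]
    congr 1
    simp [Complex.log_im]
    ring
  rw [dist_eq_norm]
  refine le_trans ?_ (Complex.abs_im_le_norm _)
  rw [him, abs_mul, abs_of_pos hμ]
  gcongr
  have h1 : (1 : ℝ) ≤ |(k : ℝ) - k'| := by
    exact_mod_cast Int.one_le_abs (sub_ne_zero.2 hne)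
  have h2 : |Complex.arg (2 * Real.pi * Complex.I * k) -
      Complex.arg (2 * Real.pi * Complex.I * k')| ≤ Real.pi := by
    refine (abs_sub _ _).trans ?_
    linarith [hre k, hre k']
  have h3 := abs_sub_abs_le_abs_sub (2 * Real.pi * ((k : ℝ) - k'))
    (Complex.arg (2 * Real.pi * Complex.I * k) - Complex.arg (2 * Real.pi * Complex.I * k'))
  rw [abs_mul, abs_of_pos Real.two_pi_pos] at h3
  nlinarith [Real.pi_pos]

/-- Far out, the small discs around approximate zeros for different data are disjoint. -/
theorem exists_disjoint_near_centre (I : Finset (ℝ × ℂ)) (hμ : ∀ p ∈ I, 0 < p.1)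
    (hρ : ∀ p ∈ I, p.2 ≠ 0) :
    ∃ ε > 0, ∃ T : ℕ, ∀ p ∈ I, ∀ p' ∈ I, ∀ k k' : ℤ, T ≤ k.natAbs → T ≤ k'.natAbs → ∀ ζ,
      dist ζ (centre p.1 p.2 k) ≤ ε → dist ζ (centre p'.1 p'.2 k') ≤ ε → p = p' ∧ k = k' := by
  by_contra! hcon
  choose p hp p' hp' k k' hk hk' ζ hζ hζ' hne using
    fun N : ℕ => hcon (1 / ((N : ℝ) + 1)) (by positivity) N
  set U : Ultrafilter ℕ := Ultrafilter.of atTop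
  have hU : (U : Filter ℕ) ≤ atTop := Ultrafilter.of_le _
  obtain ⟨⟨μ, ρ⟩, hI, hpU⟩ := (Ultrafilter.eventually_exists_mem_iff (f := U)
    (P := fun q N => p N = q) (Finset.finite_toSet I)).1
      (Eventually.of_forall fun N => ⟨p N, hp N, rfl⟩)
  obtain ⟨⟨μ', ρ'⟩, hI', hpU'⟩ := (Ultrafilter.eventually_exists_mem_iff (f := U)
    (P := fun q N => p' N = q) (Finset.finite_toSet I)).1
      (Eventually.of_forall fun N => ⟨p' N, hp' N, rfl⟩)
  have hμ0 : 0 < μ := hμ _ hI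
  have hμ0' : 0 < μ' := hμ _ hI'
  have hkU : Tendsto k U cofinite := tendsto_cofinite_of_natAbs
    ((tendsto_atTop_mono hk tendsto_id).mono_left hU)
  have hkU' : Tendsto k' U cofinite := tendsto_cofinite_of_natAbs
    ((tendsto_atTop_mono hk' tendsto_id).mono_left hU)
  have hsmall : Tendsto (fun N : ℕ => 1 / ((N : ℝ) + 1)) U (𝓝 0) :=
    tendsto_one_div_add_atTop_nhds_zero_nat.mono_left hU
  have hv : Tendsto (fun N => ζ N - centre μ ρ (k N)) U (𝓝 0) := by
    refine squeeze_zero_norm' ?_ hsmall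
    filter_upwards [hpU] with N hN
    have := hζ N
    rwa [hN, dist_eq_norm] at this
  have hv' : Tendsto (fun N => ζ N - centre μ' ρ' (k' N)) U (𝓝 0) := by
    refine squeeze_zero_norm' ?_ hsmall
    filter_upwards [hpU'] with N hN
    have := hζ' N
    rwa [hN, dist_eq_norm] at this
  have hZ := tendsto_centre_add_mul_exp hμ0 (hρ _ hI) hkU hv
  have hZ' := tendsto_centre_add_mul_exp hμ0' (hρ _ hI') hkU' hv'
  simp only [add_sub_cancel, zero_div, Complex.exp_zero, mul_one] at hZ hZ'
  have hζU : Tendsto (fun N => ‖ζ N‖) U atTop := by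
    have h1 := (tendsto_norm_cobounded_atTop.comp ((tendsto_centre hμ0 ρ).comp hkU)).atTop_add
      hv.norm.neg
    refine tendsto_atTop_mono (fun N => ?_) h1
    have := norm_sub_le (ζ N) (ζ N - centre μ ρ (k N))
    simp only [sub_sub_cancel, Function.comp] at this ⊢
    linarith
  -- the slopes agree, as `log |ζ| + Re ζ / μ` and `log |ζ| + Re ζ / μ'` both stay bounded
  have hμeq : μ = μ' := by
    by_contra hμne
    have hlog := (hZ.norm.log (norm_ne_zero_iff.2 (hρ _ hI))).const_mul μ
    have hlog' := (hZ'.norm.log (norm_ne_zero_iff.2 (hρ _ hI'))).const_mul μ'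
    have hdiff := (hlog.sub hlog').const_mul (μ - μ')⁻¹
    refine not_tendsto_nhds_of_tendsto_atTop (Real.tendsto_log_atTop.comp hζU) _
      (hdiff.congr' ?_)
    filter_upwards [hζU.eventually_gt_atTop 0] with N hN
    have hN' : ζ N ≠ 0 := norm_pos_iff.1 hN
    rw [log_norm_mul_exp hN', log_norm_mul_exp hN', Function.comp]
    have := sub_ne_zero.2 hμne
    field_simp
    ring
  subst hμeq
  have hρeq : ρ = ρ' := tendsto_nhds_unique hZ hZ'
  subst hρeq
  have hdist := (hv'.sub hv).norm
  rw [sub_zero, norm_zero] at hdist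
  obtain ⟨N, h1, h2, h3⟩ := ((hdist.eventually_lt_const
    (mul_pos hμ0 Real.pi_pos)).and (hpU.and hpU')).exists
  have h4 := le_dist_centre hμ0 ρ (hne N (h2.trans h3.symm))
  rw [dist_eq_norm] at h4
  rw [sub_sub_sub_cancel_left] at h1
  linarith

/-- All but finitely many zeros lie in the discs of radius `ε` around the approximate zeros. -/
theorem finite_zeros_away_from_centres {F : Finset ℝ} {P : ℝ → ℂ[X]} (hP : ∀ β ∈ F, P β ≠ 0)
    {M : ℕ} {b : Fin (M + 1) → ℝ} (hb : IsUpperHull F (fun β => ((P β).natDegree : ℝ)) b)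
    {μ : Fin M → ℝ} (hμ : ∀ n, 0 < μ n)
    (hslope : ∀ n,
      μ n = chordSlope (fun β => ((P β).natDegree : ℝ)) (b n.castSucc) (b n.succ))
    (hD : expPoly F P ≠ 0) {ε : ℝ} (hε : 0 < ε) (T : ℕ) :
    {ζ | expPoly F P ζ = 0 ∧ ∀ n, ∀ ρ, (edgePoly F P (μ n) (b n.castSucc)).eval ρ = 0 →
      ∀ k : ℤ, T ≤ k.natAbs → ε < dist ζ (centre (μ n) ρ k)}.Finite := by
  set A := {ζ | expPoly F P ζ = 0 ∧ ∀ n, ∀ ρ, (edgePoly F P (μ n) (b n.castSucc)).eval ρ = 0 →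
      ∀ k : ℤ, T ≤ k.natAbs → ε < dist ζ (centre (μ n) ρ k)} with hA
  suffices hbdd : IsBounded A by
    obtain ⟨R, hR⟩ := hbdd.subset_closedBall 0
    exact (finite_zeros_of_isCompact (differentiable_expPoly F P) hD
      (isCompact_closedBall (0 : ℂ) R)).subset fun ζ hζ => ⟨hR hζ, hζ.1⟩
  by_contra hunb
  have hne : (cobounded ℂ ⊓ 𝓟 A).NeBot := by
    rw [neBot_iff, Ne, inf_principal_eq_bot, ← isBounded_def]
    exact hunb
  set U : Ultrafilter ℂ := Ultrafilter.of (cobounded ℂ ⊓ 𝓟 A)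
  have hU : (U : Filter ℂ) ≤ cobounded ℂ ⊓ 𝓟 A := Ultrafilter.of_le _
  have hUA : ∀ᶠ ζ in (U : Filter ℂ), ζ ∈ A := (hU.trans inf_le_right) (mem_principal_self A)
  have hUc : (U : Filter ℂ) ≤ cobounded ℂ := hU.trans inf_le_left
  obtain ⟨n, ρ, hroot, hZ⟩ := exists_slope_root_tendsto hP hb hμ hslope U hUc
    (hUA.mono fun ζ h => h.1)
  have hρ : ρ ≠ 0 := by
    rintro rfl
    have hpos := hμ n
    rw [hslope n] at hroot hpos
    exact eval_zero_edgePoly_ne_zero hP hb n hpos hroot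
  obtain ⟨k, hk⟩ := exists_tendsto_sub_centre (hμ n) hρ hUc hZ
  have hfar : ∀ᶠ ζ in (U : Filter ℂ),
      ζ ∉ ⋃ j ∈ Finset.Ioo (-(T : ℤ)) T, closedBall (centre (μ n) ρ j) ε := by
    refine hUc (isBounded_def.1 ?_)
    exact (Bornology.isBounded_biUnion_finset _).2 fun j _ => isBounded_closedBall
  have hnear := Metric.tendsto_nhds.1 hk ε hε
  obtain ⟨ζ, h1, h2, h3⟩ := (hUA.and (hfar.and hnear)).exists
  rw [dist_zero_right, ← dist_eq_norm] at h3
  have hT : (k ζ).natAbs < T := by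
    by_contra! hle
    exact absurd (h1.2 n ρ hroot (k ζ) hle) (not_lt.2 h3.le)
  refine h2 (Set.mem_iUnion₂.2 ⟨k ζ, ?_, mem_closedBall.2 h3.le⟩)
  rw [Finset.mem_Ioo]
  omega

/-! ### Enumerating a multiset of zeros -/

/-- A multiset is enumerated, with multiplicities, by any finite type of the right cardinality. -/
theorem exists_enumeration {α κ : Type*} [DecidableEq α] [Fintype κ] (S : Multiset α)
    (h : Fintype.card κ = S.card) :
    ∃ f : κ → α, ∀ a, (Finset.univ.filter fun i => f i = a).card = S.count a := by
  obtain ⟨l, rfl⟩ := Quot.exists_rep S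
  have e : κ ≃ Fin l.length := Fintype.equivFinOfCardEq h
  refine ⟨fun i => l.get (e i), fun a => ?_⟩
  have h1 : Multiset.map l.get Finset.univ.val = (l : Multiset α) := by
    rw [Fin.univ_val_map, List.ofFn_get]
  have h2 : Multiset.map (fun i => l.get (e i)) Finset.univ.val = (l : Multiset α) := by
    conv_rhs => rw [← h1]
    rw [← Function.comp_def, ← Multiset.map_map]
    congr 1
    exact Multiset.map_univ_val_equiv e
  change _ = (l : Multiset α).count a
  rw [← h2, Multiset.count_map, Finset.card_def, Finset.filter_val]
  simp_rw [eq_comm]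

theorem encard_fiber {κ : Type*} [Fintype κ] (p : κ → Prop) [DecidablePred p] :
    {i | p i}.encard = (Finset.univ.filter p).card := by
  rw [← Set.encard_coe_eq_coe_finsetCard]; simp

theorem encard_natAbs {T : ℕ} (hT : 1 ≤ T) (x : ℤ → ℂ) (ζ : ℂ) :
    {k : ℤ | T ≤ k.natAbs ∧ x k = ζ}.encard =
      {t : ℕ | T ≤ t ∧ x t = ζ}.encard + {t : ℕ | T ≤ t ∧ x (-t) = ζ}.encard := by
  have h1 : {k : ℤ | T ≤ k.natAbs ∧ x k = ζ} =
      (fun t : ℕ => (t : ℤ)) '' {t : ℕ | T ≤ t ∧ x t = ζ} ∪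
        (fun t : ℕ => -(t : ℤ)) '' {t : ℕ | T ≤ t ∧ x (-t) = ζ} := by
    ext k
    simp only [Set.mem_ofPred_eq, Set.mem_union, Set.mem_image]
    constructor
    · rintro ⟨hk, hx⟩
      rcases Int.natAbs_eq k with h | h
      · exact Or.inl ⟨k.natAbs, ⟨hk, h ▸ hx⟩, h.symm⟩
      · exact Or.inr ⟨k.natAbs, ⟨hk, h ▸ hx⟩, h.symm⟩
    · rintro (⟨t, ⟨ht, hx⟩, rfl⟩ | ⟨t, ⟨ht, hx⟩, rfl⟩)
      · exact ⟨by simpa using ht, hx⟩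
      · exact ⟨by simpa using ht, hx⟩
  have hinj : Function.Injective fun t : ℕ => (t : ℤ) := fun a b h => by simpa using h
  have hinj' : Function.Injective fun t : ℕ => -(t : ℤ) := fun a b h => by simpa using h
  rw [h1, Set.encard_union_eq, hinj.encard_image, hinj'.encard_image]
  rw [Set.disjoint_left]
  rintro _ ⟨t, ⟨ht, -⟩, rfl⟩ ⟨t', ⟨ht', -⟩, h⟩
  simp only at h
  omega

/-- Let a multiset in the plane be given by its multiplicity function `ord`. If all but finitely
many of its elements lie in pairwise disjoint discs indexed by the elements of the multisets
`R n` and by the large integers, and if the number of elements in such a disc is the multiplicity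
of the index in `R n`, then the multiset is the union of a finite sequence and of sequences that
choose a point in each disc, one family of sequences for every element of `R n`. -/
theorem exists_sequences_of_discs {M : ℕ} (ord : ℂ → ℕ∞) (hord : ∀ ζ, ord ζ ≠ ⊤)
    (R : Fin M → Multiset ℂ) (c : Fin M → ℂ → ℤ → ℂ) {ε : ℝ} {T : ℕ} (hT : 1 ≤ T)
    (hdisj : ∀ n, ∀ ρ ∈ R n, ∀ n', ∀ ρ' ∈ R n', ∀ k k' : ℤ, T ≤ k.natAbs → T ≤ k'.natAbs → ∀ ζ,
      dist ζ (c n ρ k) ≤ ε → dist ζ (c n' ρ' k') ≤ ε → n = n' ∧ ρ = ρ' ∧ k = k')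
    (hcount : ∀ n, ∀ ρ ∈ R n, ∀ k : ℤ, T ≤ k.natAbs → ∃ S : Multiset ℂ,
      S.card = (R n).count ρ ∧ (∀ s ∈ S, dist s (c n ρ k) ≤ ε) ∧
        ∀ ζ, dist ζ (c n ρ k) ≤ ε → ord ζ = S.count ζ)
    (hfin : {ζ | ord ζ ≠ 0 ∧ ∀ n, ∀ ρ ∈ R n, ∀ k : ℤ, T ≤ k.natAbs →
      ε < dist ζ (c n ρ k)}.Finite) :
    ∃ (M₀ : ℕ) (k₀ : Fin M₀ → ℂ) (ω : (n : Fin M) → Fin (R n).card → ℂ)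
      (x : (n : Fin M) → Fin (R n).card → ℤ → ℂ), (∀ n j, ω n j ∈ R n) ∧
      (∀ n j, ∀ k : ℤ, T ≤ k.natAbs → dist (x n j k) (c n (ω n j) k) ≤ ε ∧ ord (x n j k) ≠ 0) ∧
      ∀ ζ, ord ζ = {i | k₀ i = ζ}.encard + ∑ n, ∑ j,
        ({t : ℕ | T ≤ t ∧ x n j t = ζ}.encard + {t : ℕ | T ≤ t ∧ x n j (-t) = ζ}.encard) := by
  classical
  have hω : ∀ n, ∃ ω : Fin (R n).card → ℂ,
      ∀ ρ, (Finset.univ.filter fun j => ω j = ρ).card = (R n).count ρ := fun n =>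
    exists_enumeration (R n) (by simp)
  choose ω hω using hω
  have hωmem : ∀ n j, ω n j ∈ R n := fun n j => by
    rw [← Multiset.one_le_count_iff_mem, ← hω, Finset.one_le_card]
    exact ⟨j, by simp⟩
  -- in every disc, distribute its points over the indices of the sequences
  have hx : ∀ n, ∀ k : ℤ, ∃ f : Fin (R n).card → ℂ, T ≤ k.natAbs →
      (∀ j, dist (f j) (c n (ω n j) k) ≤ ε ∧ ord (f j) ≠ 0) ∧
      ∀ ρ ∈ R n, ∀ ζ, dist ζ (c n ρ k) ≤ ε →
        ord ζ = (Finset.univ.filter fun j => ω n j = ρ ∧ f j = ζ).card := by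
    intro n k
    by_cases hk : T ≤ k.natAbs
    swap
    · exact ⟨fun _ => 0, fun h => absurd h hk⟩
    have hS : ∀ ρ, ∃ f : {j // ω n j = ρ} → ℂ, ρ ∈ R n →
        (∀ j, dist (f j) (c n ρ k) ≤ ε ∧ ord (f j) ≠ 0) ∧
        ∀ ζ, dist ζ (c n ρ k) ≤ ε → ord ζ = (Finset.univ.filter fun j => f j = ζ).card := by
      intro ρ
      by_cases hρ : ρ ∈ R n
      swap
      · exact ⟨fun _ => 0, fun h => absurd h hρ⟩
      obtain ⟨S, hcard, hSd, hSc⟩ := hcount n ρ hρ k hk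
      obtain ⟨f, hf⟩ := exists_enumeration (κ := {j // ω n j = ρ}) S
        (by rw [hcard, ← hω, Fintype.card_subtype])
      have hfS : ∀ j, f j ∈ S := fun j => by
        rw [← Multiset.one_le_count_iff_mem, ← hf, Finset.one_le_card]
        exact ⟨j, by simp⟩
      refine ⟨f, fun _ => ⟨fun j => ⟨hSd _ (hfS j), ?_⟩, fun ζ hζ => ?_⟩⟩
      · rw [hSc _ (hSd _ (hfS j))]
        simpa using hfS j
      · rw [hSc ζ hζ, hf]
    choose f hf using hS
    refine ⟨fun j => f (ω n j) ⟨j, rfl⟩, fun _ => ⟨fun j => (hf _ (hωmem n j)).1 _,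
      fun ρ hρ ζ hζ => ?_⟩⟩
    rw [(hf ρ hρ).2 ζ hζ]
    congr 1
    refine Finset.card_bij (fun j _ => j.1) ?_ (fun _ _ _ _ h => Subtype.ext h) ?_
    · rintro ⟨j, rfl⟩ hj
      simpa using hj
    · intro j hj
      obtain ⟨rfl, hj⟩ := (Finset.mem_filter.1 hj).2
      exact ⟨⟨j, rfl⟩, by simpa using hj, rfl⟩
  choose x hx using hx
  -- the finitely many points outside of the discs
  set A := hfin.toFinset with hA
  set S₀ : Multiset ℂ := ∑ ζ ∈ A, Multiset.replicate (ord ζ).toNat ζ with hS₀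
  have hS₀c : ∀ ζ, S₀.count ζ = if ζ ∈ A then (ord ζ).toNat else 0 := fun ζ => by
    rw [hS₀, Multiset.count_sum']
    simp only [Multiset.count_replicate]
    rw [Finset.sum_ite_eq' A ζ]
  obtain ⟨k₀, hk₀⟩ := exists_enumeration (κ := Fin S₀.card) S₀ (by simp)
  refine ⟨S₀.card, k₀, ω, fun n j k => x n k j, hωmem, fun n j k hk => ((hx n k hk).1 j),
    fun ζ => ?_⟩
  have hdist : ∀ n j (k : ℤ), T ≤ k.natAbs → x n k j = ζ → dist ζ (c n (ω n j) k) ≤ ε :=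
    fun n j k hk h => h ▸ ((hx n k hk).1 j).1
  suffices h : ord ζ = {i | k₀ i = ζ}.encard +
      ∑ n, ∑ j, {k : ℤ | T ≤ k.natAbs ∧ x n k j = ζ}.encard by
    rw [h]
    congr 1
    exact Finset.sum_congr rfl fun n _ => Finset.sum_congr rfl fun j _ =>
      encard_natAbs hT (fun k => x n k j) ζ
  rw [encard_fiber, hk₀, hS₀c]
  by_cases hcov : ∃ n, ∃ ρ ∈ R n, ∃ k : ℤ, T ≤ k.natAbs ∧ dist ζ (c n ρ k) ≤ ε
  · obtain ⟨n, ρ, hρ, k, hk, hζ⟩ := hcov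
    have hnA : ζ ∉ A := fun h => by
      rw [hA, Set.Finite.mem_toFinset] at h
      exact absurd (h.2 n ρ hρ k hk) (not_lt.2 hζ)
    rw [if_neg hnA, Nat.cast_zero, zero_add, Finset.sum_eq_single n, (hx n k hk).2 ρ hρ ζ hζ,
      Finset.card_filter]
    · push_cast
      refine Finset.sum_congr rfl fun j _ => ?_
      split_ifs with h
      · have : {k' : ℤ | T ≤ k'.natAbs ∧ x n k' j = ζ} = {k} := by
          ext k'
          simp only [Set.mem_ofPred_eq, Set.mem_singleton_iff]
          constructor
          · rintro ⟨hk', h'⟩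
            exact (hdisj n _ (hωmem n j) n ρ hρ k' k hk' hk ζ (hdist n j k' hk' h') hζ).2.2
          · rintro rfl
            exact ⟨hk, h.2⟩
        rw [this, Set.encard_singleton]
      · symm
        rw [Set.encard_eq_zero, Set.eq_empty_iff_forall_notMem]
        rintro k' ⟨hk', h'⟩
        obtain ⟨-, h2, rfl⟩ :=
          hdisj n _ (hωmem n j) n ρ hρ k' k hk' hk ζ (hdist n j k' hk' h') hζ
        exact h ⟨h2, h'⟩
    · intro n' _ hn'
      refine Finset.sum_eq_zero fun j _ => ?_
      rw [Set.encard_eq_zero, Set.eq_empty_iff_forall_notMem]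
      rintro k' ⟨hk', h'⟩
      exact hn' (hdisj n' _ (hωmem n' j) n ρ hρ k' k hk' hk ζ (hdist n' j k' hk' h') hζ).1
    · simp
  · push Not at hcov
    rw [Finset.sum_eq_zero, add_zero]
    · split_ifs with h
      · exact (ENat.natCast_toNat (hord ζ)).symm
      · rw [hA, Set.Finite.mem_toFinset] at h
        by_contra h0
        exact h ⟨fun h1 => h0 (by rw [h1]; rfl), hcov⟩
    · intro n _
      refine Finset.sum_eq_zero fun j _ => ?_
      rw [Set.encard_eq_zero, Set.eq_empty_iff_forall_notMem]
      rintro k ⟨hk, h⟩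
      exact absurd (hcov n _ (hωmem n j) k hk) (not_lt.2 (hdist n j k hk h))

/-! ### Zeros of exponential polynomials -/

/-- An exponential polynomial does not vanish identically, as its normalization along a segment has
a nonzero limit. -/
theorem expPoly_ne_zero {F : Finset ℝ} {P : ℝ → ℂ[X]} (hP : ∀ β ∈ F, P β ≠ 0)
    {M : ℕ} {b : Fin (M + 1) → ℝ} (hb : IsUpperHull F (fun β => ((P β).natDegree : ℝ)) b)
    (n : Fin M) (hμ : 0 < chordSlope (fun β => ((P β).natDegree : ℝ)) (b n.castSucc) (b n.succ)) :
    expPoly F P ≠ 0 := by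
  intro hzero
  have hq0 := eval_zero_edgePoly_ne_zero hP hb n hμ
  set μ := chordSlope (fun β => ((P β).natDegree : ℝ)) (b n.castSucc) (b n.succ)
  obtain ⟨w, hw⟩ : ∃ w, (edgePoly F P μ (b n.castSucc) * Polynomial.X).eval w ≠ 0 := by
    by_contra! h
    have h1 : edgePoly F P μ (b n.castSucc) * Polynomial.X = 0 :=
      Polynomial.funext fun w => by rw [h w, Polynomial.eval_zero]
    rcases mul_eq_zero.1 h1 with h2 | h2
    · exact hq0 (by rw [h2, Polynomial.eval_zero])
    · exact Polynomial.X_ne_zero h2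
  rw [Polynomial.eval_mul, Polynomial.eval_X] at hw
  have hw0 := right_ne_zero_of_mul hw
  have hc := tendsto_centre hμ w
  have hZ := tendsto_centre_add_mul_exp hμ hw0 tendsto_id (tendsto_const_nhds (x := (0 : ℂ)))
  simp only [add_zero, zero_div, Complex.exp_zero, mul_one, id] at hZ
  have hlim := tendsto_expPoly_div hμ (fun β hβ => hb.le_line n β hβ)
    (fun β hβ h => (hb.vertex_le_of_on_line n hβ h).1) hc hw0 hZ
  simp only [hzero, Pi.zero_apply, zero_div] at hlim
  exact left_ne_zero_of_mul hw (tendsto_nhds_unique hlim tendsto_const_nhds)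

/-- The zeros of an exponential polynomial whose hull has only positive slopes: up to finitely many,
they form sequences, indexed by the segments of the hull and by the roots of the polynomials of the
segments, which are asymptotic to the approximate zeros. -/
theorem exists_zero_sequences_expPoly {F : Finset ℝ} {P : ℝ → ℂ[X]} (hP : ∀ β ∈ F, P β ≠ 0)
    (hD : expPoly F P ≠ 0) {M : ℕ} {b : Fin (M + 1) → ℝ}
    (hb : IsUpperHull F (fun β => ((P β).natDegree : ℝ)) b) {μ : Fin M → ℝ} (hμ : ∀ n, 0 < μ n)
    (hslope : ∀ n,
      μ n = chordSlope (fun β => ((P β).natDegree : ℝ)) (b n.castSucc) (b n.succ)) :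
    ∃ (M₀ T : ℕ) (k₀ : Fin M₀ → ℂ)
      (ω : (n : Fin M) → Fin (edgePoly F P (μ n) (b n.castSucc)).roots.card → ℂ)
      (x : (n : Fin M) → Fin (edgePoly F P (μ n) (b n.castSucc)).roots.card → ℤ → ℂ),
      1 ≤ T ∧ (∀ n j, ω n j ≠ 0) ∧
      (∀ n j, Tendsto (fun k => x n j k - centre (μ n) (ω n j) k) cofinite (𝓝 0)) ∧
      ∀ ζ, analyticOrderAt (expPoly F P) ζ = {i | k₀ i = ζ}.encard + ∑ n, ∑ j,
        ({t : ℕ | T ≤ t ∧ x n j t = ζ}.encard + {t : ℕ | T ≤ t ∧ x n j (-t) = ζ}.encard) := by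
  classical
  set q : Fin M → ℂ[X] := fun n => edgePoly F P (μ n) (b n.castSucc) with hq
  have hq0 : ∀ n, (q n).eval 0 ≠ 0 := fun n => by
    have h := eval_zero_edgePoly_ne_zero hP hb n (hslope n ▸ hμ n)
    rwa [← hslope n] at h
  have hqne : ∀ n, q n ≠ 0 := fun n h => hq0 n (by rw [h, Polynomial.eval_zero])
  have hroot : ∀ n, ∀ ρ ∈ (q n).roots, ρ ≠ 0 := fun n ρ hρ h => by
    rw [Polynomial.mem_roots (hqne n), h] at hρ
    exact hq0 n hρ
  have hμinj : Function.Injective μ := by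
    have := hb.slopes_strictAnti.injective
    rwa [← funext hslope] at this
  set I : Finset (ℝ × ℂ) := Finset.univ.biUnion fun n => (q n).roots.toFinset.image (Prod.mk (μ n))
    with hI
  have hmemI : ∀ n, ∀ ρ ∈ (q n).roots, (μ n, ρ) ∈ I := fun n ρ hρ =>
    Finset.mem_biUnion.2 ⟨n, Finset.mem_univ _,
      Finset.mem_image_of_mem _ (Multiset.mem_toFinset.2 hρ)⟩
  have hI' : ∀ p ∈ I, ∃ n, ∃ ρ ∈ (q n).roots, p = (μ n, ρ) := fun p hp => by
    obtain ⟨n, -, hn⟩ := Finset.mem_biUnion.1 hp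
    obtain ⟨ρ, hρ, rfl⟩ := Finset.mem_image.1 hn
    exact ⟨n, ρ, Multiset.mem_toFinset.1 hρ, rfl⟩
  obtain ⟨ε₁, hε₁, T₁, hdisj⟩ := exists_disjoint_near_centre I
    (fun p hp => by obtain ⟨n, ρ, -, rfl⟩ := hI' p hp; exact hμ n)
    (fun p hp => by obtain ⟨n, ρ, hρ, rfl⟩ := hI' p hp; exact hroot n ρ hρ)
  -- one radius that works for all data
  have hnear := fun n ρ (hρ : ρ ∈ (q n).roots) => eventually_zeros_near_centre (hμ n)
    (fun β hβ => hslope n ▸ hb.le_line n β hβ)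
    (fun β hβ h => (hb.vertex_le_of_on_line n hβ (hslope n ▸ h)).1) (hqne n) (hroot n ρ hρ)
  have hall : ∀ᶠ ε in 𝓝[>] (0 : ℝ), ∀ n, ∀ ρ ∈ (q n).roots.toFinset,
      (∀ᶠ k : ℤ in cofinite, ∃ S : Multiset ℂ, S.card = (q n).rootMultiplicity ρ ∧
        (∀ s ∈ S, dist s (centre (μ n) ρ k) ≤ ε) ∧
        ∀ ζ, dist ζ (centre (μ n) ρ k) ≤ ε → analyticOrderAt (expPoly F P) ζ = S.count ζ) ∧
      ∀ δ > 0, ∀ᶠ k : ℤ in cofinite, ∀ ζ, dist ζ (centre (μ n) ρ k) ≤ ε → expPoly F P ζ = 0 →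
        dist ζ (centre (μ n) ρ k) < δ := by
    rw [eventually_all]
    intro n
    rw [Filter.eventually_all_finset]
    exact fun ρ hρ => hnear n ρ (Multiset.mem_toFinset.1 hρ)
  obtain ⟨ε, hε, hεle⟩ := (hall.and (Ioc_mem_nhdsGT hε₁)).exists
  have hcount : ∀ᶠ k : ℤ in cofinite, ∀ n, ∀ ρ ∈ (q n).roots.toFinset,
      ∃ S : Multiset ℂ, S.card = (q n).rootMultiplicity ρ ∧
        (∀ s ∈ S, dist s (centre (μ n) ρ k) ≤ ε) ∧
        ∀ ζ, dist ζ (centre (μ n) ρ k) ≤ ε → analyticOrderAt (expPoly F P) ζ = S.count ζ := by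
    rw [eventually_all]
    intro n
    rw [Filter.eventually_all_finset]
    exact fun ρ hρ => (hε n ρ hρ).1
  obtain ⟨T₂, hT₂⟩ : ∃ T₂ : ℕ, ∀ k : ℤ, T₂ ≤ k.natAbs → ∀ n, ∀ ρ ∈ (q n).roots.toFinset,
      ∃ S : Multiset ℂ, S.card = (q n).rootMultiplicity ρ ∧
        (∀ s ∈ S, dist s (centre (μ n) ρ k) ≤ ε) ∧
        ∀ ζ, dist ζ (centre (μ n) ρ k) ≤ ε → analyticOrderAt (expPoly F P) ζ = S.count ζ := by
    obtain ⟨B, hB⟩ := ((Filter.eventually_cofinite.1 hcount).image Int.natAbs).bddAbove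
    refine ⟨B + 1, fun k hk => ?_⟩
    by_contra h
    have := hB (Set.mem_image_of_mem _ h)
    omega
  have hDd := differentiable_expPoly F P
  have hord0 : ∀ ζ, analyticOrderAt (expPoly F P) ζ ≠ 0 ↔ expPoly F P ζ = 0 := fun ζ =>
    (hDd.analyticAt ζ).analyticOrderAt_ne_zero
  obtain ⟨M₀, k₀, ω, x, hω, hx, hord⟩ := exists_sequences_of_discs
    (analyticOrderAt (expPoly F P)) (analyticOrderAt_ne_top_of_differentiable hDd hD)
    (fun n => (q n).roots) (fun n => centre (μ n)) (ε := ε) (T := T₁ + T₂ + 1) (by omega)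
    (fun n ρ hρ n' ρ' hρ' k k' hk hk' ζ hζ hζ' => by
      obtain ⟨h1, h2⟩ := hdisj _ (hmemI n ρ hρ) _ (hmemI n' ρ' hρ') k k' (by omega) (by omega) ζ
        (hζ.trans hεle.2) (hζ'.trans hεle.2)
      exact ⟨hμinj (Prod.ext_iff.1 h1).1, (Prod.ext_iff.1 h1).2, h2⟩)
    (fun n ρ hρ k hk => by
      rw [Polynomial.count_roots]
      exact hT₂ k (by omega) n ρ (Multiset.mem_toFinset.2 hρ))
    ((finite_zeros_away_from_centres hP hb hμ hslope hD hεle.1 (T₁ + T₂ + 1)).subset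
      fun ζ hζ => ⟨(hord0 ζ).1 hζ.1, fun n ρ hρ =>
        hζ.2 n ρ ((Polynomial.mem_roots (hqne n)).2 hρ)⟩)
  refine ⟨M₀, T₁ + T₂ + 1, k₀, ω, x, by omega, fun n j => hroot n _ (hω n j), fun n j => ?_, hord⟩
  rw [Metric.tendsto_nhds]
  intro δ hδ
  have hlarge : ∀ᶠ k : ℤ in cofinite, T₁ + T₂ + 1 ≤ k.natAbs := by
    refine (Filter.eventually_cofinite.2 ((Set.finite_Icc (-((T₁ + T₂ + 1 : ℕ) : ℤ))
      ((T₁ + T₂ + 1 : ℕ) : ℤ)).subset fun k hk => ?_))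
    rw [Set.mem_ofPred_eq, not_le] at hk
    rw [Set.mem_Icc]
    omega
  filter_upwards [(hε n _ (Multiset.mem_toFinset.2 (hω n j))).2 δ hδ, hlarge] with k hk hkT
  rw [dist_zero_right, ← dist_eq_norm]
  exact hk _ (hx n j k hkT).1 ((hord0 _).1 (hx n j k hkT).2)

/-! ### The asymptotics in the resonance plane -/

theorem I_mul_centre_neg_div {μ : ℝ} (hμ : 0 < μ) (ω : ℂ) {t : ℕ} (ht : 1 ≤ t) :
    Complex.I * centre μ ω (-t) / μ =
      2 * (Real.pi : ℂ) * (t : ℂ) - Complex.I * Complex.log (t : ℂ) - (Real.pi : ℂ) / 2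
        - Complex.I * Complex.log (2 * (Real.pi : ℂ) * (μ : ℂ)) + Complex.I * Complex.log ω := by
  have hμ' : (μ : ℂ) ≠ 0 := Complex.ofReal_ne_zero.2 hμ.ne'
  have ht' : (0 : ℝ) < t := by exact_mod_cast ht
  have hpi := Real.two_pi_pos
  have h1 : Complex.log (2 * Real.pi * Complex.I * ((-t : ℤ) : ℂ)) =
      ((Real.log (2 * Real.pi) + Real.log t : ℝ) : ℂ) - Real.pi / 2 * Complex.I := by
    have : (2 * Real.pi * Complex.I * ((-t : ℤ) : ℂ) : ℂ) =
        ((2 * Real.pi * t : ℝ) : ℂ) * -Complex.I := by push_cast; ring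
    rw [this, Complex.log_ofReal_mul (mul_pos hpi ht') (neg_ne_zero.2 Complex.I_ne_zero),
      Complex.log_neg_I, Real.log_mul hpi.ne' ht'.ne']
    ring
  have h2 : Complex.log (2 * (Real.pi : ℂ) * (μ : ℂ)) =
      ((Real.log (2 * Real.pi) + Real.log μ : ℝ) : ℂ) := by
    rw [← Real.log_mul hpi.ne' hμ.ne', Complex.ofReal_log (mul_pos hpi hμ).le]
    push_cast; rfl
  rw [centre, h1, h2, ← Complex.natCast_log, ← Complex.ofReal_log hμ.le]
  push_cast
  field_simp
  linear_combination (-4 * (Real.pi : ℂ) * t + Real.pi) * Complex.I_sq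

theorem I_mul_centre_div {μ : ℝ} (hμ : 0 < μ) (ω : ℂ) {t : ℕ} (ht : 1 ≤ t) :
    Complex.I * centre μ ω t / μ =
      -(2 * (Real.pi : ℂ) * (t : ℂ)) - Complex.I * Complex.log (t : ℂ) + (Real.pi : ℂ) / 2
        - Complex.I * Complex.log (2 * (Real.pi : ℂ) * (μ : ℂ)) + Complex.I * Complex.log ω := by
  have hμ' : (μ : ℂ) ≠ 0 := Complex.ofReal_ne_zero.2 hμ.ne'
  have ht' : (0 : ℝ) < t := by exact_mod_cast ht
  have hpi := Real.two_pi_pos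
  have h1 : Complex.log (2 * Real.pi * Complex.I * ((t : ℤ) : ℂ)) =
      ((Real.log (2 * Real.pi) + Real.log t : ℝ) : ℂ) + Real.pi / 2 * Complex.I := by
    have : (2 * Real.pi * Complex.I * ((t : ℤ) : ℂ) : ℂ) =
        ((2 * Real.pi * t : ℝ) : ℂ) * Complex.I := by push_cast; ring
    rw [this, Complex.log_ofReal_mul (mul_pos hpi ht') Complex.I_ne_zero,
      Complex.log_I, Real.log_mul hpi.ne' ht'.ne']
  have h2 : Complex.log (2 * (Real.pi : ℂ) * (μ : ℂ)) =
      ((Real.log (2 * Real.pi) + Real.log μ : ℝ) : ℂ) := by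
    rw [← Real.log_mul hpi.ne' hμ.ne', Complex.ofReal_log (mul_pos hpi hμ).le]
    push_cast; rfl
  rw [centre, h1, h2, ← Complex.natCast_log, ← Complex.ofReal_log hμ.le]
  push_cast
  field_simp
  linear_combination (4 * (Real.pi : ℂ) * t - Real.pi) * Complex.I_sq

/-! ### The frequencies of the characteristic determinant -/

section Frequencies

variable {N : ℕ} (a : Fin N → ℂ) {y : Fin N → E3}

theorem expPoly_freqs (hy : Function.Injective y) :
    expPoly (freqs a y) (freqPoly a y) = modDet a y :=
  funext fun ζ => (modDet_eq_sum a y hy ζ).symm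

theorem freqPoly_ne_zero {β : ℝ} (hβ : β ∈ freqs a y) : freqPoly a y β ≠ 0 :=
  (Finset.mem_filter.1 hβ).2

theorem mem_freqs_of_ne_zero {β : ℝ} (h : freqPoly a y β ≠ 0) : β ∈ freqs a y := by
  refine Finset.mem_filter.2 ⟨?_, h⟩
  by_contra hβ
  refine h (Finset.sum_eq_zero fun σ hσ => ?_)
  exact absurd (Finset.mem_image.2 ⟨σ, Finset.mem_univ σ, (Finset.mem_filter.1 hσ).2⟩) hβ

theorem alpha_eq_zero_iff (hy : Function.Injective y) (σ : Equiv.Perm (Fin N)) :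
    alpha y σ = 0 ↔ σ = 1 := by
  rw [alpha, neg_eq_zero, Finset.sum_eq_zero_iff_of_nonneg fun _ _ => norm_nonneg _]
  constructor
  · intro h
    ext1 j
    by_contra hj
    have := h j (Finset.mem_filter.2 ⟨Finset.mem_univ j, hj⟩)
    exact hj (hy (sub_eq_zero.1 (norm_eq_zero.1 this))).symm
  · rintro rfl j hj
    exact absurd rfl (Finset.mem_filter.1 hj).2

/-- Each point that is moved contributes at most the diameter to `-α(σ)`. -/
theorem neg_mul_card_le_alpha {d : ℝ} (hd : ∀ i j, ‖y i - y j‖ ≤ d) (σ : Equiv.Perm (Fin N)) :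
    -(d * σ.support.card) ≤ alpha y σ := by
  rw [alpha, neg_le_neg_iff]
  refine (Finset.sum_le_card_nsmul _ _ d fun j _ => hd _ _).trans_eq ?_
  rw [nsmul_eq_mul, mul_comm]
  rfl

theorem card_fixed_add_card_support (σ : Equiv.Perm (Fin N)) :
    (Finset.univ.filter fun j => σ j = j).card + σ.support.card = N := by
  have := Finset.card_filter_add_card_filter_not (s := Finset.univ) (fun j : Fin N => σ j = j)
  rw [Finset.card_univ, Fintype.card_fin] at this
  exact this

theorem natDegree_neg_X_sub_C (c : ℂ) : (-Polynomial.X - Polynomial.C c : ℂ[X]).natDegree = 1 := by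
  rw [← neg_add', Polynomial.natDegree_neg, Polynomial.natDegree_X_add_C]

theorem leadingCoeff_neg_X_sub_C (c : ℂ) :
    (-Polynomial.X - Polynomial.C c : ℂ[X]).leadingCoeff = -1 := by
  rw [← neg_add', Polynomial.leadingCoeff_neg, Polynomial.leadingCoeff_X_add_C]

theorem prod_inv_norm_pos (hy : Function.Injective y) (σ : Equiv.Perm (Fin N)) :
    0 < ∏ j with σ j ≠ j, ‖y j - y (σ j)‖⁻¹ := by
  refine Finset.prod_pos fun j hj => inv_pos.2 (norm_pos_iff.2 (sub_ne_zero.2 fun h => ?_))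
  exact (Finset.mem_filter.1 hj).2 (hy h).symm

theorem natDegree_permPoly (hy : Function.Injective y) (σ : Equiv.Perm (Fin N)) :
    (permPoly a y σ).natDegree = N - σ.support.card := by
  have hc : (((Equiv.Perm.sign σ : ℤ) : ℂ) *
      ((∏ j with σ j ≠ j, ‖y j - y (σ j)‖⁻¹ : ℝ) : ℂ)) ≠ 0 := by
    refine mul_ne_zero (Int.cast_ne_zero.2 (Units.ne_zero _)) ?_
    exact Complex.ofReal_ne_zero.2 (prod_inv_norm_pos hy σ).ne'
  have hne : ∀ j : Fin N, (-Polynomial.X - Polynomial.C (4 * (Real.pi : ℂ) * a j) : ℂ[X]) ≠ 0 :=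
    fun j => Polynomial.leadingCoeff_ne_zero.1 (by rw [leadingCoeff_neg_X_sub_C]; simp)
  rw [permPoly, Polynomial.natDegree_C_mul hc, Polynomial.natDegree_prod _ _ fun j _ => hne j]
  simp_rw [natDegree_neg_X_sub_C]
  have := card_fixed_add_card_support σ
  rw [Finset.sum_const, smul_eq_mul, mul_one]
  omega

theorem leadingCoeff_permPoly (σ : Equiv.Perm (Fin N)) :
    (permPoly a y σ).leadingCoeff = ((Equiv.Perm.sign σ : ℤ) : ℂ) *
      ((∏ j with σ j ≠ j, ‖y j - y (σ j)‖⁻¹ : ℝ) : ℂ) * (-1) ^ (N - σ.support.card) := by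
  rw [permPoly, Polynomial.leadingCoeff_mul, Polynomial.leadingCoeff_C,
    Polynomial.leadingCoeff_prod]
  simp_rw [leadingCoeff_neg_X_sub_C]
  rw [Finset.prod_const]
  congr 2
  have := card_fixed_add_card_support σ
  omega

/-- All points `T_β` lie below the line of slope `1 / d` through `(0, N)`, where `d` is the
diameter. -/
theorem height_le (hy : Function.Injective y) {d : ℝ} (hd0 : 0 < d)
    (hd : ∀ i j, ‖y i - y j‖ ≤ d) {β : ℝ} (hβ : β ∈ freqs a y) : height a y β ≤ N + β / d := by
  have hσ : ∀ σ : Equiv.Perm (Fin N), alpha y σ = β →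
      (((permPoly a y σ).natDegree : ℕ) : ℝ) ≤ N + β / d := fun σ h => by
    have h1 := card_fixed_add_card_support σ
    have h2 : -(σ.support.card : ℝ) ≤ β / d := by
      rw [le_div_iff₀ hd0, ← h]
      have := neg_mul_card_le_alpha hd σ
      linarith
    rw [natDegree_permPoly a hy, Nat.cast_sub (by omega)]
    linarith
  obtain ⟨σ₀, -, hσ₀⟩ := Finset.mem_image.1 (Finset.mem_filter.1 hβ).1
  have h0 : 0 ≤ (N : ℝ) + β / d := (Nat.cast_nonneg _).trans (hσ σ₀ hσ₀)
  rw [height, ← Nat.le_floor_iff h0]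
  refine Polynomial.natDegree_sum_le_of_forall_le _ _ fun σ h => ?_
  exact Nat.le_floor (hσ σ (Finset.mem_filter.1 h).2)

theorem freq_nonpos {β : ℝ} (hβ : β ∈ freqs a y) : β ≤ 0 := by
  obtain ⟨σ, -, rfl⟩ := Finset.mem_image.1 (Finset.mem_filter.1 hβ).1
  exact neg_nonpos.2 (Finset.sum_nonneg fun _ _ => norm_nonneg _)

theorem natDegree_freqPoly_zero (hy : Function.Injective y) :
    0 ∈ freqs a y ∧ (freqPoly a y 0).natDegree = N := by
  have h1 : freqPoly a y 0 = permPoly a y 1 := by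
    rw [freqPoly]
    refine Finset.sum_eq_single_of_mem 1 (Finset.mem_filter.2 ⟨Finset.mem_univ _,
      (alpha_eq_zero_iff hy 1).2 rfl⟩) fun σ hσ hne => ?_
    exact absurd ((alpha_eq_zero_iff hy σ).1 (Finset.mem_filter.1 hσ).2) hne
  refine ⟨mem_freqs_of_ne_zero a ?_, ?_⟩
  · rw [h1, ← Polynomial.leadingCoeff_ne_zero, leadingCoeff_permPoly]
    simp
  · rw [h1, natDegree_permPoly a hy]
    simp

/-- The frequency `-2 d`, with `d` the diameter: only transpositions contribute to the coefficient
of `ζ ^ (N - 2)`, and as they all have the same sign there is no cancellation. -/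
theorem natDegree_freqPoly_neg_two_mul (hy : Function.Injective y) {d : ℝ} (hd0 : 0 < d)
    (hd : ∀ i j, ‖y i - y j‖ ≤ d) {i₀ j₀ : Fin N} (h₀ : ‖y i₀ - y j₀‖ = d) :
    -(2 * d) ∈ freqs a y ∧ (freqPoly a y (-(2 * d))).natDegree = N - 2 := by
  have hij : i₀ ≠ j₀ := fun h => by rw [h, sub_self, norm_zero] at h₀; exact hd0.ne h₀
  have hsupp : ∀ σ : Equiv.Perm (Fin N), alpha y σ = -(2 * d) → 2 ≤ σ.support.card := fun σ h => by
    have h1 := neg_mul_card_le_alpha hd σ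
    have h2 : (2 : ℝ) ≤ σ.support.card := by
      rw [h] at h1
      by_contra! h3
      nlinarith
    exact_mod_cast h2
  have hcoeff : ∀ σ : Equiv.Perm (Fin N), alpha y σ = -(2 * d) →
      (permPoly a y σ).coeff (N - 2) = -(-1) ^ (N - 2) * ((if σ.support.card = 2 then
        ∏ j with σ j ≠ j, ‖y j - y (σ j)‖⁻¹ else 0 : ℝ) : ℂ) := fun σ h => by
    split_ifs with h2
    · have hdeg := natDegree_permPoly a hy σ
      rw [h2] at hdeg
      rw [← hdeg, Polynomial.coeff_natDegree, leadingCoeff_permPoly, h2, hdeg,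
        (Equiv.Perm.card_support_eq_two.1 h2).sign_eq]
      push_cast
      ring
    · have h3 := card_fixed_add_card_support σ
      have h4 := hsupp σ h
      rw [Polynomial.coeff_eq_zero_of_natDegree_lt]
      · simp
      · rw [natDegree_permPoly a hy]
        omega
  set τ := Equiv.swap i₀ j₀ with hτ
  have hτα : alpha y τ = -(2 * d) := by
    have hs : (Finset.univ.filter fun j => τ j ≠ j) = {i₀, j₀} := Equiv.Perm.support_swap hij
    rw [alpha, hs, Finset.sum_pair hij, hτ, Equiv.swap_apply_left, Equiv.swap_apply_right,
      norm_sub_rev (y j₀), h₀]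
    ring
  have hτ2 : τ.support.card = 2 := Equiv.Perm.card_support_swap hij
  have hne : (freqPoly a y (-(2 * d))).coeff (N - 2) ≠ 0 := by
    rw [freqPoly, Polynomial.finsetSum_coeff,
      Finset.sum_congr rfl fun σ hσ => hcoeff σ (Finset.mem_filter.1 hσ).2, ← Finset.mul_sum]
    refine mul_ne_zero (neg_ne_zero.2 (pow_ne_zero _ (by norm_num))) ?_
    rw [← Complex.ofReal_sum, Complex.ofReal_ne_zero]
    refine (Finset.sum_pos' (fun σ _ => ?_)
      ⟨τ, Finset.mem_filter.2 ⟨Finset.mem_univ _, hτα⟩, ?_⟩).ne'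
    · split_ifs
      · exact (prod_inv_norm_pos hy σ).le
      · exact le_rfl
    · rw [if_pos hτ2]
      exact prod_inv_norm_pos hy τ
  have hmem := mem_freqs_of_ne_zero a (y := y) (β := -(2 * d)) fun h => hne (by rw [h]; simp)
  refine ⟨hmem, le_antisymm ?_ (Polynomial.le_natDegree_of_ne_zero hne)⟩
  have h1 := height_le a hy hd0 hd hmem
  have h2 : -(2 * d) / d = -2 := by field_simp
  rw [height, h2] at h1
  have h3 : ((freqPoly a y (-(2 * d))).natDegree : ℝ) + 2 ≤ N := by linarith
  have h4 : (freqPoly a y (-(2 * d))).natDegree + 2 ≤ N := by exact_mod_cast h3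
  omega

theorem exists_norm_eq_diam (hN : 2 ≤ N) (hy : Function.Injective y) :
    0 < Metric.diam (Set.range y) ∧ (∀ i j, ‖y i - y j‖ ≤ Metric.diam (Set.range y)) ∧
      ∃ i j, ‖y i - y j‖ = Metric.diam (Set.range y) := by
  have hle : ∀ i j, ‖y i - y j‖ ≤ Metric.diam (Set.range y) := fun i j => by
    rw [← dist_eq_norm]
    exact Metric.dist_le_diam_of_mem (Set.finite_range y).isBounded ⟨i, rfl⟩ ⟨j, rfl⟩
  refine ⟨?_, hle, ?_⟩
  · have h01 : (⟨0, by omega⟩ : Fin N) ≠ ⟨1, by omega⟩ := by simp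
    exact (norm_pos_iff.2 (sub_ne_zero.2 (hy.ne h01))).trans_le (hle _ _)
  · obtain ⟨p, -, hp⟩ := (Finset.univ : Finset (Fin N × Fin N)).exists_max_image
      (fun p => ‖y p.1 - y p.2‖) ⟨(⟨0, by omega⟩, ⟨0, by omega⟩), Finset.mem_univ _⟩
    refine ⟨p.1, p.2, le_antisymm (hle _ _) (Metric.diam_le_of_forall_dist_le (norm_nonneg _) ?_)⟩
    rintro _ ⟨i, rfl⟩ _ ⟨j, rfl⟩
    rw [dist_eq_norm]
    exact hp (i, j) (Finset.mem_univ _)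

end Frequencies

/-! ### Resonances -/

theorem resonanceMult_eq {N : ℕ} (a : Fin N → ℂ) (y : Fin N → E3) (hy : Function.Injective y)
    (z : ℂ) : resonanceMult a y z =
      analyticOrderAt (expPoly (freqs a y) (freqPoly a y)) (-Complex.I * z) := by
  have hpi : (-4 * (Real.pi : ℂ)) ^ N ≠ 0 :=
    pow_ne_zero _ (mul_ne_zero (by norm_num) (Complex.ofReal_ne_zero.2 Real.pi_ne_zero))
  have h1 : (fun z => (Gam a y z).det) =
      fun z => (expPoly (freqs a y) (freqPoly a y) ∘ fun w => -Complex.I * w) z *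
        ((-4 * (Real.pi : ℂ)) ^ N)⁻¹ := by
    funext z
    rw [expPoly_freqs a hy, Function.comp, modDet, ← mul_assoc,
      show Complex.I * -Complex.I = 1 by rw [mul_neg, Complex.I_mul_I, neg_neg], one_mul]
    field_simp
  rw [resonanceMult, h1, analyticOrderAt_mul_const
    ((differentiable_expPoly _ _).comp (by fun_prop)) (inv_ne_zero hpi)]
  refine analyticOrderAt_comp_of_deriv_ne_zero (g := fun w : ℂ => -Complex.I * w) (by fun_prop) ?_
  have h2 : HasDerivAt (fun w : ℂ => -Complex.I * w) (-Complex.I * 1) z :=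
    (hasDerivAt_id z).const_mul _
  rw [h2.deriv]
  simp

/-! ### The distribution diagram -/

section Diagram

variable {N : ℕ} {a : Fin N → ℂ} {y : Fin N → E3} {M : ℕ} {b : Fin (M + 1) → ℝ}

theorem IsUpperHull.isDistributionDiagram (hb : IsUpperHull (freqs a y) (height a y) b) :
    IsDistributionDiagram a y b where
  mem := hb.mem
  strictMono := hb.strictMono
  first_le := hb.first_le
  le_last := hb.le_last
  slopes_strictAnti := hb.slopes_strictAnti
  below n β hβ _ _ := hb.le_line n β hβ

/-- The last segment of the diagram ends at `(0, N)`, has slope `1 / d`, with `d` the diameter, and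
reaches to the left at least as far as `-2 d`. -/
theorem IsUpperHull.exists_last_segment (hb : IsUpperHull (freqs a y) (height a y) b)
    (hy : Function.Injective y) {d : ℝ} (hd0 : 0 < d) (hd : ∀ i j, ‖y i - y j‖ ≤ d)
    (hex : ∃ i j, ‖y i - y j‖ = d) :
    ∃ n : Fin M, n.succ = Fin.last M ∧ b n.succ = 0 ∧ b n.castSucc ≤ -(2 * d) ∧
      chordSlope (height a y) (b n.castSucc) (b n.succ) = 1 / d := by
  obtain ⟨i₀, j₀, h₀⟩ := hex
  obtain ⟨hz, hz'⟩ := natDegree_freqPoly_zero a hy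
  obtain ⟨ht, ht'⟩ := natDegree_freqPoly_neg_two_mul a hy hd0 hd h₀
  have hN : 2 ≤ N := by
    have hij : i₀ ≠ j₀ := fun h => by rw [h, sub_self, norm_zero] at h₀; exact hd0.ne h₀
    have := Fin.val_ne_of_ne hij
    omega
  have hh0 : height a y 0 = N := by rw [height, hz']
  have hht : height a y (-(2 * d)) = N - 2 := by rw [height, ht', Nat.cast_sub hN]; norm_num
  have hline : ∀ β ∈ freqs a y, height a y β ≤ height a y (-(2 * d)) + 1 / d * (β - -(2 * d)) :=
    fun β hβ => (height_le a hy hd0 hd hβ).trans_eq (by rw [hht]; field_simp; ring)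
  obtain ⟨n, hn⟩ := hb.exists_slope_eq ht hz (by linarith)
    (by rw [hh0, hht]; field_simp; ring) hline
  -- the line of the segment is the supporting line
  have h1 := hb.le_line n 0 hz
  have h2 := height_le a hy hd0 hd (hb.mem n.castSucc)
  have h3 : height a y (b n.castSucc) = N + b n.castSucc / d := by
    rw [hn, hh0] at h1
    refine le_antisymm h2 ?_
    have : 1 / d * (0 - b n.castSucc) = -(b n.castSucc / d) := by ring
    linarith
  have h4 := (hb.vertex_le_of_on_line n hz (by rw [hn, hh0, h3]; ring)).2
  have h5 := (hb.vertex_le_of_on_line n ht (by rw [hn, hht, h3]; field_simp; ring)).1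
  have h6 := freq_nonpos a (hb.mem n.succ)
  refine ⟨n, ?_, le_antisymm h6 h4, h5, hn⟩
  by_contra hne
  have h7 := hb.strictMono (lt_of_le_of_ne (Fin.le_last _) hne)
  have h8 := freq_nonpos a (hb.mem (Fin.last M))
  linarith

end Diagram

end PointInteraction

theorem theoremt {N : ℕ} (hN : 2 ≤ N) (y : Fin N → PointInteraction.E3)
    (hy : Function.Injective y) (a : Fin N → ℂ) :
    ∃ (M M₀ : ℕ) (hM : 1 ≤ M) (μ : Fin M → ℝ) (r : Fin M → ℕ)
      (ω : (n : Fin M) → Fin (r n) → ℂ) (t₀ : (n : Fin M) → Fin (r n) → ℕ)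
      (k₀ : Fin M₀ → ℂ) (kp km : (n : Fin M) → Fin (r n) → ℕ → ℂ)
      (b : Fin (M + 1) → ℝ),
      -- the ranges of the parameters
      (∀ n, 0 < μ n) ∧ (∀ n, 1 ≤ r n) ∧ (∀ n j, ω n j ≠ 0) ∧ (∀ n j, 1 ≤ t₀ n j) ∧
      -- the `μ n` are the slopes of the successive segments of the distribution diagram
      PointInteraction.IsDistributionDiagram a y b ∧
      (∀ n, μ n = PointInteraction.slopeT a y (b n.castSucc) (b n.succ)) ∧
      -- the multiset of resonances is the union of `k₀` and of all the sequences
      -- `(kp n j t)` and `(km n j t)`, `t ≥ t₀ n j`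
      (∀ z : ℂ, PointInteraction.resonanceMult a y z =
        {i : Fin M₀ | k₀ i = z}.encard +
          ∑ n : Fin M, ∑ j : Fin (r n),
            ({t : ℕ | t₀ n j ≤ t ∧ km n j t = z}.encard +
              {t : ℕ | t₀ n j ≤ t ∧ kp n j t = z}.encard)) ∧
      -- the asymptotics of the sequences
      (∀ n j, Filter.Tendsto (fun t : ℕ => kp n j t / (μ n : ℂ) -
          (2 * (Real.pi : ℂ) * (t : ℂ) - Complex.I * Complex.log (t : ℂ) - (Real.pi : ℂ) / 2
            - Complex.I * Complex.log (2 * (Real.pi : ℂ) * (μ n : ℂ))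
            + Complex.I * Complex.log (ω n j)))
        Filter.atTop (nhds 0)) ∧
      (∀ n j, Filter.Tendsto (fun t : ℕ => km n j t / (μ n : ℂ) -
          (-(2 * (Real.pi : ℂ) * (t : ℂ)) - Complex.I * Complex.log (t : ℂ) + (Real.pi : ℂ) / 2
            - Complex.I * Complex.log (2 * (Real.pi : ℂ) * (μ n : ℂ))
            + Complex.I * Complex.log (ω n j)))
        Filter.atTop (nhds 0)) ∧
      -- the leading parameters
      StrictAnti μ ∧ μ ⟨M - 1, by omega⟩ = 1 / Metric.diam (Set.range y) ∧
      -- the numbers of parameters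
      M ≤ N - 1 ∧ 2 ≤ r ⟨M - 1, by omega⟩ ∧ r ⟨M - 1, by omega⟩ ≤ ∑ n, r n ∧ ∑ n, r n ≤ N := by
  open PointInteraction Filter Topology in
  obtain ⟨hd0, hd, hex⟩ := exists_norm_eq_diam hN hy
  set d := Metric.diam (Set.range y)
  have hF := (natDegree_freqPoly_zero a hy).1
  obtain ⟨M, b, hb⟩ := exists_isUpperHull (height a y) (freqs a y) ⟨0, hF⟩
  obtain ⟨m, hmlast, hm0, hm2, hmslope⟩ := hb.exists_last_segment hy hd0 hd hex
  have hM : 1 ≤ M := m.pos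
  have hmval : m = ⟨M - 1, by omega⟩ := by
    have := congrArg Fin.val hmlast
    simp only [Fin.val_succ, Fin.val_last] at this
    exact Fin.ext (by simp only; omega)
  set μ : Fin M → ℝ := fun n => chordSlope (height a y) (b n.castSucc) (b n.succ) with hμdef
  have hanti : StrictAnti μ := hb.slopes_strictAnti
  have hμ : ∀ n, 0 < μ n := fun n => by
    have h1 : n ≤ m := by rw [hmval, Fin.le_def]; simp only; omega
    have h2 : μ m ≤ μ n := hanti.antitone h1
    exact lt_of_lt_of_le (by rw [hμdef]; simp only; rw [hmslope]; positivity) h2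
  have hP : ∀ β ∈ freqs a y, freqPoly a y β ≠ 0 := fun β => freqPoly_ne_zero a
  obtain ⟨M₀, T, k₀, ω, x, hT, hω, hx, hcount⟩ := exists_zero_sequences_expPoly hP
    (expPoly_ne_zero hP hb m (hμ m)) hb hμ fun n => rfl
  -- the numbers of roots are the differences of the heights of the vertices
  set r : Fin M → ℕ := fun n =>
    (edgePoly (freqs a y) (freqPoly a y) (μ n) (b n.castSucc)).roots.card with hr
  set D : Fin (M + 1) → ℕ := fun i => (freqPoly a y (b i)).natDegree with hDdef
  have hDmul : ∀ n : Fin M, (D n.castSucc : ℝ) + μ n * (b n.succ - b n.castSucc) = D n.succ :=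
    fun n => add_chordSlope_mul (height a y) (hb.strictMono Fin.castSucc_lt_succ).ne
  have hDlt : ∀ n : Fin M, D n.castSucc < D n.succ := fun n => by
    have h1 := mul_pos (hμ n) (sub_pos.2 (hb.strictMono (Fin.castSucc_lt_succ (i := n))))
    have h2 : (D n.castSucc : ℝ) < D n.succ := by linarith [hDmul n]
    exact_mod_cast h2
  have hrD : ∀ n, D n.castSucc + r n = D n.succ := fun n => by
    have h1 : r n = D n.succ - D n.castSucc := by
      rw [hr, ← natDegree_edgePoly hP hb n (hμ n)]
      exact (IsAlgClosed.splits _).natDegree_eq_card_roots.symm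
    have := hDlt n
    omega
  have hr1 : ∀ n, 1 ≤ r n := fun n => by
    have := hrD n
    have := hDlt n
    omega
  have hr2 : 2 ≤ r m := by
    have h1 : (2 : ℝ) ≤ r m := by
      have h2 := hDmul m
      rw [← hrD m, show μ m = 1 / d from hmslope, hm0] at h2
      push_cast at h2
      have h3 : (2 : ℝ) ≤ 1 / d * (0 - b m.castSucc) := by
        rw [one_div, inv_mul_eq_div, le_div_iff₀ hd0]
        linarith
      linarith
    exact_mod_cast h1
  have hsum : ∑ n, r n + D 0 = N := by
    have h1 : ∑ n : Fin M, D n.castSucc + ∑ n, r n = ∑ n : Fin M, D n.succ := by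
      rw [← Finset.sum_add_distrib]
      exact Finset.sum_congr rfl fun n _ => hrD n
    have h2 := Fin.sum_univ_castSucc D
    rw [Fin.sum_univ_succ] at h2
    have h3 : D (Fin.last M) = N := by
      rw [← hmlast]
      simp only [hDdef, hm0]
      exact (natDegree_freqPoly_zero a hy).2
    omega
  have hMr : M + 1 ≤ ∑ n, r n := by
    have h1 : ∑ n : Fin M, (1 + if n = m then 1 else 0) ≤ ∑ n, r n := by
      refine Finset.sum_le_sum fun n _ => ?_
      split_ifs with h
      · rw [h]; exact hr2
      · exact hr1 n
    rw [Finset.sum_add_distrib] at h1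
    simpa using h1
  have hI : ∀ w z : ℂ, Complex.I * w = z ↔ w = -Complex.I * z := fun w z => by
    constructor
    · rintro rfl
      linear_combination w * Complex.I_sq
    · rintro rfl
      linear_combination -z * Complex.I_sq
  -- the displacements from the approximate zeros, rotated to the plane of the resonances
  have hlim : ∀ n j (k : ℕ → ℤ), Tendsto k atTop cofinite → Tendsto (fun t =>
      Complex.I * x n j (k t) / μ n - Complex.I * centre (μ n) (ω n j) (k t) / μ n) atTop (𝓝 0) :=
    fun n j k hk => by
      have h1 := (((hx n j).comp hk).const_mul Complex.I).div_const (μ n : ℂ)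
      rw [mul_zero, zero_div] at h1
      refine h1.congr fun t => ?_
      simp only [Function.comp]
      ring
  refine ⟨M, M₀, hM, μ, r, ω, fun _ _ => T, fun i => Complex.I * k₀ i,
    fun n j t => Complex.I * x n j (-t), fun n j t => Complex.I * x n j t, b, hμ, hr1, hω,
    fun _ _ => hT, hb.isDistributionDiagram, fun n => rfl, fun z => ?_, fun n j => ?_,
    fun n j => ?_, hanti, ?_, by omega, hmval ▸ hr2, ?_, by omega⟩
  · simp only [hI]
    rw [resonanceMult_eq a y hy, hcount]
  · refine (hlim n j (fun t => -t) (tendsto_cofinite_of_natAbs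
      (tendsto_id.congr fun t => by simp))).congr' ?_
    filter_upwards [eventually_ge_atTop 1] with t ht
    rw [I_mul_centre_neg_div (hμ n) _ ht]
  · refine (hlim n j (fun t => t) (tendsto_cofinite_of_natAbs
      (tendsto_id.congr fun t => by simp))).congr' ?_
    filter_upwards [eventually_ge_atTop 1] with t ht
    rw [I_mul_centre_div (hμ n) _ ht]
  · rw [← hmval]
    exact hmslope
  · exact Finset.single_le_sum (f := r) (fun _ _ => Nat.zero_le _) (Finset.mem_univ _)
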